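/- Let $(\Omega,\Sigma)$ be a measurable space, let $X$ and $E$ be real Banach spaces and let $m:\Sigma\to X$ be a countably additive vector measure. For $x^*\in X^*$ write $\langle m,x^*\rangle(A)=\langle m(A),x^*\rangle$. A set $A\in\Sigma$ is $m$-null if $m(B)=0$ for all $B\in\Sigma$ with $B\subseteq A$. A measurable function $h:\Omega\to\mathbb R$ is integrable with respect to $m$ if it is integrable with respect to every $|\langle m,x^*\rangle|$ and for each $A\in\Sigma$ there is an element $\int_A h\,dm\in X$ with $\langle\int_A h\,dm,x^*\rangle=\int_A h\,d\langle m,x^*\rangle$ for all $x^*\in X^*$; we write $\int h\,dm$ for $\int_\Omega h\,dm$. For $1\le p<\infty$ let $L^p(m)$ be the space of (classes modulo $m$-null sets of) measurable functions $f:\Omega\to\mathbb R$ such that $|f|^p$ is integrable with respect to $m$, with the norm $\|f\|=\big(\sup_{\|x^*\|\le1}\int|f|^p\,d|\langle m,x^*\rangle|\big)^{1/p}$; let $L^\infty(m)$ be the space of (classes of) functions that are essentially bounded modulo $m$-null sets, with the essential supremum norm. Let $1\le p,p'\le\infty$ with $1/p+1/p'=1$; then $fg\in L^1(m)$ for $f\in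 L^p(m)$ and $g\in L^{p'}(m)$. For a subspace $R$ of one of these spaces, $B_R$ is its closed unit ball. For linear subspaces $P\subseteq L^p(m)$ and $R\subseteq L^{p'}(m)$ (or $P\subseteq L^{p'}(m)$ and $R\subseteq L^{p}(m)$), we say that $R$ is $m$-norming for $P$ if $f\mapsto\sup_{g\in B_R}\|\int fg\,dm\|$ is a norm on $P$ equivalent to the given one, and $\tau_m(R)$ is the topology on $P$ generated by the seminorms $f\mapsto\|\int fg\,dm\|$, $g\in R$. Let $(P,P^m,P^{mm})$ be an $m$-dual system, i.e. $P\subseteq P^{mm}\subseteq L^p(m)$ and $P^m\subseteq L^{p'}(m)$ are linear subspaces, $P^m$ is $m$-norming for $P$, and $P^{mm}$ is $m$-norming for $P^m$. Let $1\le q<\infty$ and let $T:P\to E$ be a bounded linear operator that is $(q,P^m)$-summing: there is a constant $K$ such that for all finite families $f_1,\dots,f_n\in P$ $$\Big(\sum_{i=1}^n\|T(f_i)\|^q\Big)^{1/q}\le K\sup_{g\in B_{P^m}}\Big(\sum_{i=1}^n\Big\|\int f_ig\,dm\Big\|^q\Big)^{1/q}.$$ (i) If $B_{P^m}$ is $\tau_m(P^{mm})$-compact,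 then $T$ is $\tau_m(P^m)$-sequentially completely continuous: $\|T(f_n)\|\to0$ for every bounded sequence $(f_n)$ in $P$ such that $\|\int f_nh\,dm\|\to0$ for all $h\in P^m$. (ii) If $B_P$ is $\tau_m(P^m)$-compact and $B_{P^m}$ is $\tau_m(P^{mm})$-compact, then $T$ is completely continuous: it maps weakly convergent sequences to norm convergent sequences. (iii) If $B_{P^m}$ is $\tau_m(P^{mm})$-compact and $X$ is reflexive, then $T$ is weakly compact: $T(B_P)$ is relatively weakly compact in $E$. -/

import Mathlib

open MeasureTheory Filter Topology
open scoped ENNReal NNReal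

namespace VecLp

section Integrals

variable {Ω X : Type*} [MeasurableSpace Ω] [NormedAddCommGroup X] [NormedSpace ℝ X]

/-- The scalar measure `⟨m, x'⟩ : A ↦ x' (m A)` attached to a vector measure `m` and `x' ∈ X*`.
Its variation `(scalar m x').variation` is the positive measure `|⟨m, x'⟩|`. -/
noncomputable def scalar (m : VectorMeasure Ω X) (x' : StrongDual ℝ X) : VectorMeasure Ω ℝ :=
  m.mapRange (x' : X →+ ℝ) x'.continuous

/-- `x` is the integral `∫_A h dm`: `x' x = ∫_A h d⟨m, x'⟩` for every `x' ∈ X*`. -/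
def IsIntegralOn (m : VectorMeasure Ω X) (h : Ω → ℝ) (A : Set Ω) (x : X) : Prop :=
  ∀ x' : StrongDual ℝ X, x' x = ∫ᵛ ω in A, h ω ∂<•(scalar m x')

/-- `h` is integrable with respect to the vector measure `m`: it is measurable, it is integrable
with respect to every `|⟨m, x'⟩|`, and `∫_A h dm` exists in `X` for every measurable set `A`.
(A set is null for the measure `m.variation` iff `m` vanishes on all its measurable subsets.) -/
structure IsIntegrable (m : VectorMeasure Ω X) (h : Ω → ℝ) : Prop where
  aesm : AEStronglyMeasurable h m.variation
  integrable_scalar : ∀ x' : StrongDual ℝ X, MeasureTheory.Integrable h (scalar m x').variation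
  exists_integral : ∀ A : Set Ω, MeasurableSet A → ∃ x : X, IsIntegralOn m h A x

/-- Membership in `L^p(m)`: for `p < ∞` the function `|f|^p` is integrable with respect to `m`;
for `p = ∞` the function `f` is essentially bounded (modulo `m`-null sets). -/
def MemLp (m : VectorMeasure Ω X) (p : ℝ≥0∞) (f : Ω → ℝ) : Prop :=
  if p = ∞ then MeasureTheory.MemLp f ∞ m.variation
  else AEStronglyMeasurable f m.variation ∧ IsIntegrable m (fun ω => |f ω| ^ p.toReal)

/-- The norm of `L^p(m)`, with values in `[0, ∞]`: for `p < ∞` it is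
`(sup_{‖x'‖ ≤ 1} ∫ |f|^p d|⟨m, x'⟩|)^(1/p)`, and for `p = ∞` it is the essential supremum of `|f|`
modulo `m`-null sets. -/
noncomputable def lpENorm (m : VectorMeasure Ω X) (p : ℝ≥0∞) (f : Ω → ℝ) : ℝ≥0∞ :=
  if p = ∞ then eLpNorm f ∞ m.variation
  else (⨆ x' ∈ {x' : StrongDual ℝ X | ‖x'‖ ≤ 1},
    ∫⁻ ω, ‖f ω‖ₑ ^ p.toReal ∂(scalar m x').variation) ^ (1 / p.toReal)

lemma scalar_variation_ac (m : VectorMeasure Ω X) (x' : StrongDual ℝ X) :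
    (scalar m x').variation ≪ m.variation := by
  refine Measure.AbsolutelyContinuous.mk fun s hs h => ?_
  rw [VectorMeasure.variation_apply_eq_zero hs] at h ⊢
  intro t hts ht
  change x' (m t) = 0
  rw [h t hts ht, map_zero]

lemma ae_of_scalar (m : VectorMeasure Ω X) {s : Set Ω} (hs : MeasurableSet s)
    (h : ∀ x' : StrongDual ℝ X, ‖x'‖ ≤ 1 → (scalar m x').variation s = 0) :
    m.variation s = 0 := by
  rw [VectorMeasure.variation_apply_eq_zero hs]
  intro t hts ht
  obtain ⟨l, hl, hl'⟩ := exists_dual_vector'' ℝ (m t)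
  have := (VectorMeasure.variation_apply_eq_zero hs).1 (h l hl) t hts ht
  change l (m t) = 0 at this
  rw [hl'] at this
  simpa using this

lemma IsIntegralOn.unique {m : VectorMeasure Ω X} {h : Ω → ℝ} {A : Set Ω} {x y : X}
    (hx : IsIntegralOn m h A x) (hy : IsIntegralOn m h A y) : x = y :=
  SeparatingDual.eq_iff_forall_dual_eq (R := ℝ) |>.2 fun x' => (hx x').trans (hy x').symm

lemma IsIntegrable.congr {m : VectorMeasure Ω X} {h k : Ω → ℝ} (hh : IsIntegrable m h)
    (e : h =ᵐ[m.variation] k) : IsIntegrable m k where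
  aesm := hh.aesm.congr e
  integrable_scalar x' := (hh.integrable_scalar x').congr ((scalar_variation_ac m x').ae_eq e)
  exists_integral A hA := by
    obtain ⟨x, hx⟩ := hh.exists_integral A hA
    refine ⟨x, fun x' => (hx x').trans ?_⟩
    exact VectorMeasure.setIntegral_congr_ae
      (((scalar_variation_ac m x').ae_eq e).mono fun _ h _ => h)

lemma IsIntegrable.add {m : VectorMeasure Ω X} {h k : Ω → ℝ} (hh : IsIntegrable m h)
    (hk : IsIntegrable m k) : IsIntegrable m (fun ω => h ω + k ω) where
  aesm := hh.aesm.add hk.aesm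
  integrable_scalar x' := (hh.integrable_scalar x').add (hk.integrable_scalar x')
  exists_integral A hA := by
    obtain ⟨x, hx⟩ := hh.exists_integral A hA
    obtain ⟨y, hy⟩ := hk.exists_integral A hA
    refine ⟨x + y, fun x' => ?_⟩
    rw [map_add, hx, hy, VectorMeasure.integral_fun_add]
    · exact VectorMeasure.Integrable.integrableOn (hh.integrable_scalar x')
    · exact VectorMeasure.Integrable.integrableOn (hk.integrable_scalar x')

lemma IsIntegrable.const_mul {m : VectorMeasure Ω X} {h : Ω → ℝ} (hh : IsIntegrable m h)
    (c : ℝ) : IsIntegrable m (fun ω => c * h ω) where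
  aesm := hh.aesm.const_mul c
  integrable_scalar x' := (hh.integrable_scalar x').const_mul c
  exists_integral A hA := by
    obtain ⟨x, hx⟩ := hh.exists_integral A hA
    refine ⟨c • x, fun x' => ?_⟩
    rw [map_smul, hx]
    exact (VectorMeasure.integral_fun_smul _ _ c h).symm

/-- Restriction of an integrable function to a measurable set. -/
lemma IsIntegrable.indicator {m : VectorMeasure Ω X} {h : Ω → ℝ} (hh : IsIntegrable m h)
    {B : Set Ω} (hB : MeasurableSet B) : IsIntegrable m (B.indicator h) where
  aesm := hh.aesm.indicator hB
  integrable_scalar x' := (hh.integrable_scalar x').indicator hB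
  exists_integral A hA := by
    obtain ⟨x, hx⟩ := hh.exists_integral (A ∩ B) (hA.inter hB)
    exact ⟨x, fun x' => (hx x').trans (VectorMeasure.setIntegral_indicator hA hB).symm⟩

/-- The integral of a nonnegative function against the variation of a signed measure is controlled
by its integrals against the signed measure over sets. -/
lemma lintegral_variation_le {ν : VectorMeasure Ω ℝ} {h : Ω → ℝ} (h0 : ∀ ω, 0 ≤ h ω)
    (hh : MeasureTheory.Integrable h ν.variation) {C : ℝ}
    (hC : ∀ A, MeasurableSet A → ‖∫ᵛ ω in A, h ω ∂<•ν‖ ≤ C) :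
    ∫⁻ ω, ‖h ω‖ₑ ∂ν.variation ≤ ENNReal.ofReal (2 * C) := by
  have hC0 : 0 ≤ C := (norm_nonneg _).trans (hC ∅ MeasurableSet.empty)
  obtain ⟨s, hs, hpos, hneg, h1, h2⟩ := SignedMeasure.toJordanDecomposition_spec ν
  set π := (SignedMeasure.toJordanDecomposition ν).posPart with hπ
  set η := (SignedMeasure.toJordanDecomposition ν).negPart with hη
  have e : ν.variation = π + η := by
    rw [← SignedMeasure.totalVariation_eq_variation]; rfl
  rw [e] at hh
  have r1 : ν.restrict s = π.toSignedMeasure := by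
    ext A hA
    rw [VectorMeasure.restrict_apply _ hs hA, Measure.toSignedMeasure_apply_measurable hA, h1,
      SignedMeasure.toMeasureOfZeroLE_real_apply _ hpos hs hA, Set.inter_comm]
  have r2 : ν.restrict sᶜ = -η.toSignedMeasure := by
    ext A hA
    rw [VectorMeasure.restrict_apply _ hs.compl hA, _root_.neg_apply,
      Measure.toSignedMeasure_apply_measurable hA, h2,
      SignedMeasure.toMeasureOfLEZero_real_apply _ hneg hs.compl hA, Set.inter_comm, neg_neg]
  have c1 := hC s hs
  have c2 := hC sᶜ hs.compl
  have i1 := hh.left_of_add_measure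
  have i2 := hh.right_of_add_measure
  rw [r1] at c1
  rw [r2, VectorMeasure.integral_neg_vectorMeasure] at c2
  rw [VectorMeasure.integral_toSignedMeasure] at c1
  rw [VectorMeasure.integral_toSignedMeasure, norm_neg] at c2
  have key : ∀ κ : Measure Ω, MeasureTheory.Integrable h κ → ‖∫ ω, h ω ∂κ‖ ≤ C →
      ∫⁻ ω, ‖h ω‖ₑ ∂κ ≤ ENNReal.ofReal C := by
    intro κ hκ hc
    have : ∫⁻ ω, ‖h ω‖ₑ ∂κ = ENNReal.ofReal (∫ ω, h ω ∂κ) := by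
      rw [ofReal_integral_eq_lintegral_ofReal hκ (ae_of_all _ h0)]
      exact lintegral_congr fun ω => Real.enorm_of_nonneg (h0 ω)
    rw [this]
    exact ENNReal.ofReal_le_ofReal ((le_abs_self _).trans hc)
  rw [e, lintegral_add_measure, two_mul, ENNReal.ofReal_add hC0 hC0]
  exact add_le_add (key _ i1 c1) (key _ i2 c2)

lemma enorm_setIntegral_le (ν : VectorMeasure Ω ℝ) (h : Ω → ℝ) (A : Set Ω) :
    ‖∫ᵛ ω in A, h ω ∂<•ν‖ₑ ≤ ∫⁻ ω, ‖h ω‖ₑ ∂ν.variation := by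
  refine (VectorMeasure.enorm_setIntegral_le_lintegral_enorm_transpose).trans ?_
  rw [VectorMeasure.variation_transpose_lsmul_flip]
  exact setLIntegral_le_lintegral _ _

/-- Uniform boundedness of `∫ h d|⟨m, x'⟩|` over the dual unit ball. -/
lemma IsIntegrable.exists_bound {m : VectorMeasure Ω X} {h : Ω → ℝ} (hh : IsIntegrable m h)
    (h0 : ∀ ω, 0 ≤ h ω) : ∃ C : ℝ, 0 ≤ C ∧ ∀ x' : StrongDual ℝ X,
      ∫⁻ ω, ‖h ω‖ₑ ∂(scalar m x').variation ≤ ENNReal.ofReal (C * ‖x'‖) := by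
  choose! v hv using hh.exists_integral
  let g : {A : Set Ω // MeasurableSet A} → StrongDual ℝ (StrongDual ℝ X) :=
    fun A => NormedSpace.inclusionInDoubleDual ℝ X (v A.1)
  have hg : ∀ x', ∃ C, ∀ A, ‖g A x'‖ ≤ C := by
    intro x'
    refine ⟨(∫⁻ ω, ‖h ω‖ₑ ∂(scalar m x').variation).toReal, fun A => ?_⟩
    have : g A x' = _ := hv A.1 A.2 x'
    rw [this, ← toReal_enorm]
    refine ENNReal.toReal_mono (hh.integrable_scalar x').2.ne ?_
    exact enorm_setIntegral_le _ _ _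
  obtain ⟨C, hC⟩ := banach_steinhaus hg
  have hC0 : 0 ≤ C := (norm_nonneg _).trans (hC ⟨∅, MeasurableSet.empty⟩)
  refine ⟨2 * C, by positivity, fun x' => ?_⟩
  rw [mul_assoc]
  refine lintegral_variation_le h0 (hh.integrable_scalar x') fun A hA => ?_
  rw [← hv A hA x']
  exact (g ⟨A, hA⟩).le_of_opNorm_le (hC _) x'

/-- Products of a simple function and an integrable function are integrable. -/
lemma IsIntegrable.simpleFunc_mul {m : VectorMeasure Ω X} {h : Ω → ℝ} (hh : IsIntegrable m h)
    (s : SimpleFunc Ω ℝ) : IsIntegrable m (fun ω => s ω * h ω) := by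
  induction s using SimpleFunc.induction with
  | const c hs =>
    rename_i B
    refine ((hh.indicator hs).const_mul c).congr (ae_of_all _ fun ω => ?_)
    by_cases hω : ω ∈ B <;> simp [hω]
  | @add f g hfg hf hg =>
    refine (hf.add hg).congr (ae_of_all _ fun ω => ?_)
    simp [add_mul]

/-- `L^1(m)` is an ideal: a measurable function dominated by an integrable one is integrable. -/
lemma IsIntegrable.mono [CompleteSpace X] {m : VectorMeasure Ω X} {h k : Ω → ℝ}
    (hh : IsIntegrable m h) (h0 : ∀ ω, 0 ≤ h ω) (hk : AEStronglyMeasurable k m.variation)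
    (hkh : ∀ᵐ ω ∂m.variation, |k ω| ≤ h ω) : IsIntegrable m k where
  aesm := hk
  integrable_scalar x' := (hh.integrable_scalar x').mono'
    (hk.mono_ac (scalar_variation_ac m x')) ((scalar_variation_ac m x').ae_le hkh)
  exists_integral A hA := by
    have hki : ∀ x', MeasureTheory.Integrable k (scalar m x').variation := fun x' =>
      (hh.integrable_scalar x').mono'
        (hk.mono_ac (scalar_variation_ac m x')) ((scalar_variation_ac m x').ae_le hkh)
    obtain ⟨C, hC0, hC⟩ := hh.exists_bound h0
    obtain ⟨k', hk'm, hk'⟩ := hk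
    obtain ⟨h', hh'm, hh'⟩ := hh.aesm
    let φ : Ω → ℝ := fun ω => k' ω / h' ω
    have hφm : Measurable φ := hk'm.measurable.div hh'm.measurable
    have hφ : ∀ᵐ ω ∂m.variation, |φ ω| ≤ 1 ∧ k ω = φ ω * h ω := by
      filter_upwards [hk', hh', hkh] with ω a b c
      simp only [φ, ← a, ← b]
      rcases (h0 ω).eq_or_lt with e | e
      · rw [← e] at c ⊢
        have : k ω = 0 := abs_eq_zero.1 (le_antisymm c (abs_nonneg _))
        simp [this]
      · refine ⟨?_, by field_simp⟩
        rw [abs_div, abs_of_pos e]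
        exact (div_le_one e).2 c
    let ψ : ℕ → Ω → ℝ := fun n ω => (⌊(n + 1 : ℝ) * max (-1) (min 1 (φ ω))⌋ : ℝ) / (n + 1)
    have hψm : ∀ n, Measurable (ψ n) := fun n => by
      have : Measurable fun ω => (n + 1 : ℝ) * max (-1) (min 1 (φ ω)) :=
        (measurable_const.max (measurable_const.min hφm)).const_mul _
      exact ((measurable_from_top (f := fun z : ℤ => (z : ℝ))).comp
        (Int.measurable_floor.comp this)).div_const _
    have hψf : ∀ n, (Set.range (ψ n)).Finite := fun n => by
      refine (((Set.finite_Icc (-(n + 1 : ℤ)) (n + 1)).image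
        (fun z : ℤ => (z : ℝ) / (n + 1)))).subset ?_
      rintro _ ⟨ω, rfl⟩
      refine ⟨⌊(n + 1 : ℝ) * max (-1) (min 1 (φ ω))⌋, ⟨?_, ?_⟩, rfl⟩
      · rw [Int.le_floor]
        have : (-1 : ℝ) ≤ max (-1) (min 1 (φ ω)) := le_max_left _ _
        push_cast
        nlinarith [(Nat.cast_nonneg n : (0 : ℝ) ≤ n)]
      · have : max (-1 : ℝ) (min 1 (φ ω)) ≤ 1 := max_le (by norm_num) (min_le_left _ _)
        have h1 := Int.floor_le ((n + 1 : ℝ) * max (-1) (min 1 (φ ω)))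
        have h2 : (⌊(n + 1 : ℝ) * max (-1) (min 1 (φ ω))⌋ : ℝ) ≤ ((n + 1 : ℤ) : ℝ) := by
          push_cast
          nlinarith [(Nat.cast_nonneg n : (0 : ℝ) ≤ n)]
        exact_mod_cast h2
    let s : ℕ → SimpleFunc Ω ℝ := fun n =>
      ⟨ψ n, fun y => hψm n (measurableSet_singleton y), hψf n⟩
    have hs : ∀ n, ∀ᵐ ω ∂m.variation, |s n ω * h ω - k ω| ≤ 1 / (n + 1) * h ω := by
      intro n
      filter_upwards [hφ] with ω a
      rw [a.2, ← sub_mul, abs_mul, abs_of_nonneg (h0 ω)]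
      refine mul_le_mul_of_nonneg_right ?_ (h0 ω)
      have hn : (0 : ℝ) < n + 1 := by positivity
      change |ψ n ω - φ ω| ≤ _
      have e : max (-1 : ℝ) (min 1 (φ ω)) = φ ω := by
        rw [min_eq_right (abs_le.1 a.1).2, max_eq_right (abs_le.1 a.1).1]
      simp only [ψ, e]
      have h1 := Int.floor_le ((n + 1 : ℝ) * φ ω)
      have h2 := Int.lt_floor_add_one ((n + 1 : ℝ) * φ ω)
      rw [abs_le, div_sub' hn.ne', le_div_iff₀ hn, div_le_div_iff_of_pos_right hn, neg_mul,
        one_div_mul_cancel hn.ne']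
      constructor <;> linarith
    choose x hx using fun n => (hh.simpleFunc_mul (s n)).exists_integral A hA
    have hest : ∀ n x', |x' (x n) - ∫ᵛ ω in A, k ω ∂<•(scalar m x')|
        ≤ 1 / (n + 1) * (C * ‖x'‖) := by
      intro n x'
      have hi := (hh.simpleFunc_mul (s n)).integrable_scalar x'
      rw [hx n x', ← VectorMeasure.integral_fun_sub
        (VectorMeasure.Integrable.integrableOn hi) (VectorMeasure.Integrable.integrableOn (hki x'))]
      rw [← Real.norm_eq_abs, ← ENNReal.ofReal_le_ofReal_iff (by positivity), ofReal_norm]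
      refine (enorm_setIntegral_le _ _ _).trans ?_
      have hn : (0 : ℝ) ≤ 1 / (n + 1) := by positivity
      calc ∫⁻ ω, ‖s n ω * h ω - k ω‖ₑ ∂(scalar m x').variation
          ≤ ∫⁻ ω, ENNReal.ofReal (1 / (n + 1)) * ‖h ω‖ₑ ∂(scalar m x').variation := by
            refine lintegral_mono_ae ((scalar_variation_ac m x').ae_le ((hs n).mono ?_))
            intro ω hω
            rw [← ofReal_norm, Real.norm_eq_abs, Real.enorm_of_nonneg (h0 ω),
              ← ENNReal.ofReal_mul hn]
            exact ENNReal.ofReal_le_ofReal hω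
        _ ≤ _ := by
            rw [lintegral_const_mul' _ _ ENNReal.ofReal_ne_top, ENNReal.ofReal_mul hn]
            gcongr
            exact hC x'
    have hlim : Tendsto (fun n : ℕ => 2 * (1 / ((n : ℝ) + 1)) * C) atTop (𝓝 0) := by
      simpa using (tendsto_one_div_add_atTop_nhds_zero_nat.const_mul (2 : ℝ)).mul_const C
    have hcau : CauchySeq x := by
      refine cauchySeq_of_le_tendsto_0 (fun n : ℕ => 2 * (1 / ((n : ℝ) + 1)) * C)
        (fun n l N hn hl => ?_) hlim
      rw [dist_eq_norm]
      refine NormedSpace.norm_le_dual_bound ℝ _ (by positivity) fun x' => ?_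
      have e1 := hest n x'
      have e2 := hest l x'
      have a1 : (1 : ℝ) / (n + 1) ≤ 1 / (N + 1) :=
        one_div_le_one_div_of_le (by positivity) (by exact_mod_cast Nat.succ_le_succ hn)
      have a2 : (1 : ℝ) / (l + 1) ≤ 1 / (N + 1) :=
        one_div_le_one_div_of_le (by positivity) (by exact_mod_cast Nat.succ_le_succ hl)
      have hCx : 0 ≤ C * ‖x'‖ := by positivity
      have b1 := mul_le_mul_of_nonneg_right a1 hCx
      have b2 := mul_le_mul_of_nonneg_right a2 hCx
      rw [map_sub, Real.norm_eq_abs, abs_le]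
      rw [abs_le] at e1 e2
      constructor <;> nlinarith [e1.1, e1.2, e2.1, e2.2]
    obtain ⟨y, hy⟩ := cauchySeq_tendsto_of_complete hcau
    refine ⟨y, fun x' => ?_⟩
    have t1 : Tendsto (fun n => x' (x n)) atTop (𝓝 (x' y)) := (x'.continuous.tendsto y).comp hy
    refine tendsto_nhds_unique t1 ?_
    rw [tendsto_iff_dist_tendsto_zero]
    have t2 : Tendsto (fun n : ℕ => 1 / ((n : ℝ) + 1) * (C * ‖x'‖)) atTop (𝓝 0) := by
      simpa using tendsto_one_div_add_atTop_nhds_zero_nat.mul_const (C * ‖x'‖)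
    exact squeeze_zero (fun _ => dist_nonneg) (fun n => hest n x') t2

/-! ### Closure properties of `L^p(m)` -/

lemma MemLp.aesm {m : VectorMeasure Ω X} {p : ℝ≥0∞} {f : Ω → ℝ} (hf : MemLp m p f) :
    AEStronglyMeasurable f m.variation := by
  unfold MemLp at hf
  split_ifs at hf
  · exact hf.1
  · exact hf.1

lemma aesm_abs_rpow {μ : Measure Ω} {f : Ω → ℝ} (hf : AEStronglyMeasurable f μ) (r : ℝ) :
    AEStronglyMeasurable (fun ω => |f ω| ^ r) μ :=
  (hf.aemeasurable.norm.pow_const r).aestronglyMeasurable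

lemma abs_add_rpow_le (a b : ℝ) {r : ℝ} (hr : 0 ≤ r) :
    |a + b| ^ r ≤ 2 ^ r * (|a| ^ r + |b| ^ r) := by
  have h1 : |a + b| ≤ 2 * max |a| |b| := by
    have := abs_add_le a b
    have := le_max_left |a| |b|
    have := le_max_right |a| |b|
    linarith
  have h2 : max |a| |b| ^ r ≤ |a| ^ r + |b| ^ r := by
    rcases max_choice |a| |b| with e | e <;> rw [e] <;>
      linarith [Real.rpow_nonneg (abs_nonneg a) r, Real.rpow_nonneg (abs_nonneg b) r]
  calc |a + b| ^ r ≤ (2 * max |a| |b|) ^ r := Real.rpow_le_rpow (abs_nonneg _) h1 hr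
    _ = 2 ^ r * max |a| |b| ^ r := Real.mul_rpow (by norm_num) (le_max_of_le_left (abs_nonneg _))
    _ ≤ _ := by gcongr

lemma MemLp.const_smul {m : VectorMeasure Ω X} {p : ℝ≥0∞} {f : Ω → ℝ} (hf : MemLp m p f)
    (c : ℝ) : MemLp m p (c • f) := by
  have hfm := hf.aesm
  unfold MemLp at *
  split_ifs at * with h
  · exact MeasureTheory.MemLp.const_smul hf c
  · refine ⟨hfm.const_smul c, (hf.2.const_mul (|c| ^ p.toReal)).congr (ae_of_all _ fun ω => ?_)⟩
    simp [abs_mul, Real.mul_rpow]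

lemma IsIntegrable.zero (m : VectorMeasure Ω X) : IsIntegrable m (fun _ => (0 : ℝ)) where
  aesm := aestronglyMeasurable_const
  integrable_scalar _ := integrable_zero _ _ _
  exists_integral A _ := ⟨0, fun x' => by
    rw [map_zero]
    exact (VectorMeasure.integral_zero (μ := (scalar m x').restrict A)).symm⟩

lemma MemLp.zero (m : VectorMeasure Ω X) {p : ℝ≥0∞} (hp : 1 ≤ p) : MemLp m p (0 : Ω → ℝ) := by
  unfold MemLp
  split_ifs with h
  · exact MeasureTheory.MemLp.zero
  · have h0 : p.toReal ≠ 0 := (ENNReal.toReal_pos (one_pos.trans_le hp).ne' h).ne'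
    refine ⟨aestronglyMeasurable_const, ?_⟩
    simpa [h0] using IsIntegrable.zero m

lemma MemLp.congr {m : VectorMeasure Ω X} {p : ℝ≥0∞} {f g : Ω → ℝ} (hf : MemLp m p f)
    (e : f =ᵐ[m.variation] g) : MemLp m p g := by
  have hfm := hf.aesm
  unfold MemLp at *
  split_ifs at * with h
  · exact hf.ae_eq e
  · exact ⟨hfm.congr e, hf.2.congr (e.mono fun ω hω => by simp only [hω])⟩

lemma lpENorm_congr {m : VectorMeasure Ω X} {p : ℝ≥0∞} {f g : Ω → ℝ}
    (e : f =ᵐ[m.variation] g) : lpENorm m p f = lpENorm m p g := by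
  unfold lpENorm
  split_ifs with h
  · exact eLpNorm_congr_ae e
  · congr 1
    refine iSup_congr fun x' => iSup_congr fun _ => lintegral_congr_ae ?_
    filter_upwards [(scalar_variation_ac m x').ae_eq e] with ω hω
    rw [hω]

lemma MemLp.lpENorm_lt_top {m : VectorMeasure Ω X} {p : ℝ≥0∞} {f : Ω → ℝ}
    (hf : MemLp m p f) : lpENorm m p f < ∞ := by
  unfold MemLp at hf
  unfold lpENorm
  split_ifs at * with h
  · exact hf.2
  · obtain ⟨C, hC0, hC⟩ := hf.2.exists_bound fun ω => by positivity
    refine ENNReal.rpow_lt_top_of_nonneg (by positivity) (ne_top_of_le_ne_top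
      (ENNReal.ofReal_ne_top (r := C)) (iSup₂_le fun x' hx' => ?_))
    refine le_trans (le_of_eq ?_) ((hC x').trans (ENNReal.ofReal_le_ofReal ?_))
    · refine lintegral_congr fun ω => ?_
      have e : ‖|f ω| ^ p.toReal‖ₑ = ENNReal.ofReal (|f ω| ^ p.toReal) :=
        Real.enorm_of_nonneg (by positivity)
      rw [e, ← ofReal_norm, Real.norm_eq_abs,
        ENNReal.ofReal_rpow_of_nonneg (abs_nonneg _) ENNReal.toReal_nonneg]
    · exact mul_le_of_le_one_right hC0 hx'

lemma lpENorm_const_smul (m : VectorMeasure Ω X) {p : ℝ≥0∞} (hp : 1 ≤ p) (c : ℝ) (f : Ω → ℝ) :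
    lpENorm m p (c • f) = ‖c‖ₑ * lpENorm m p f := by
  unfold lpENorm
  split_ifs with h
  · exact eLpNorm_const_smul c f ∞ _
  · have h0 : 0 < p.toReal := ENNReal.toReal_pos (one_pos.trans_le hp).ne' h
    have : ∀ x' : StrongDual ℝ X, ∫⁻ ω, ‖(c • f) ω‖ₑ ^ p.toReal ∂(scalar m x').variation
        = ‖c‖ₑ ^ p.toReal * ∫⁻ ω, ‖f ω‖ₑ ^ p.toReal ∂(scalar m x').variation := by
      intro x'
      rw [← lintegral_const_mul' _ _ (by finiteness)]
      refine lintegral_congr fun ω => ?_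
      rw [Pi.smul_apply, enorm_smul, ENNReal.mul_rpow_of_nonneg _ _ h0.le]
    simp only [this, ← ENNReal.mul_iSup]
    rw [ENNReal.mul_rpow_of_nonneg _ _ (by positivity), ← ENNReal.rpow_mul,
      mul_one_div_cancel h0.ne', ENNReal.rpow_one]

lemma lpENorm_add_le {m : VectorMeasure Ω X} {p : ℝ≥0∞} (hp : 1 ≤ p) {f g : Ω → ℝ}
    (hf : AEStronglyMeasurable f m.variation) (hg : AEStronglyMeasurable g m.variation) :
    lpENorm m p (f + g) ≤ lpENorm m p f + lpENorm m p g := by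
  by_cases h : p = ∞
  · simp only [lpENorm, if_pos h]
    exact eLpNorm_add_le hf hg le_top
  have hp0 : p ≠ 0 := (one_pos.trans_le hp).ne'
  have h0 : 0 < p.toReal := ENNReal.toReal_pos hp0 h
  have le : ∀ (k : Ω → ℝ) (x' : StrongDual ℝ X), ‖x'‖ ≤ 1 →
      eLpNorm k p (scalar m x').variation ≤ lpENorm m p k := by
    intro k x' hx'
    rw [lpENorm, if_neg h, eLpNorm_eq_lintegral_rpow_enorm_toReal hp0 h]
    refine ENNReal.rpow_le_rpow ?_ (by positivity)
    exact le_iSup₂ (f := fun (x' : StrongDual ℝ X) (_ : x' ∈ {x' : StrongDual ℝ X | ‖x'‖ ≤ 1}) =>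
      ∫⁻ ω, ‖k ω‖ₑ ^ p.toReal ∂(scalar m x').variation) x' hx'
  rw [lpENorm, if_neg h, one_div, ENNReal.rpow_inv_le_iff h0]
  refine iSup₂_le fun x' hx' => ?_
  rw [← ENNReal.rpow_inv_le_iff h0, ← one_div, ← eLpNorm_eq_lintegral_rpow_enorm_toReal hp0 h]
  exact (eLpNorm_add_le (hf.mono_ac (scalar_variation_ac m x'))
    (hg.mono_ac (scalar_variation_ac m x')) hp).trans (add_le_add (le f x' hx') (le g x' hx'))

lemma ae_eq_zero_of_lpENorm {m : VectorMeasure Ω X} {p : ℝ≥0∞} (hp : 1 ≤ p) {f : Ω → ℝ}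
    (hf : StronglyMeasurable f) (h : lpENorm m p f = 0) : f =ᵐ[m.variation] 0 := by
  unfold lpENorm at h
  split_ifs at h with hp'
  · exact (eLpNorm_eq_zero_iff hf.aestronglyMeasurable (by simp)).1 h
  · have h0 : 0 < p.toReal := ENNReal.toReal_pos (one_pos.trans_le hp).ne' hp'
    rw [ENNReal.rpow_eq_zero_iff_of_pos (by positivity)] at h
    simp only [← bot_eq_zero, iSup_eq_bot] at h
    simp only [bot_eq_zero] at h
    have hS : MeasurableSet {ω | ¬ f ω = 0} :=
      (hf.measurable (measurableSet_singleton (0 : ℝ))).compl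
    refine ae_of_scalar m hS fun x' hx' => ?_
    have h1 := h x' hx'
    rw [lintegral_eq_zero_iff (hf.measurable.enorm.pow_const _)] at h1
    refine measure_mono_null ?_ h1
    intro ω hω h2
    refine hω ?_
    simpa [ENNReal.rpow_eq_zero_iff_of_pos h0] using h2

/-- Products of functions in `L^p(m)` and `L^{p'}(m)`, for conjugate exponents, are integrable. -/
lemma MemLp.mul [CompleteSpace X] {m : VectorMeasure Ω X} {p p' : ℝ≥0∞}
    [hpp : p.HolderConjugate p'] {f g : Ω → ℝ} (hf : MemLp m p f) (hg : MemLp m p' g) :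
    MemLp m 1 (f * g) := by
  have hfm := hf.aesm
  have hgm := hg.aesm
  have red : ∀ k : Ω → ℝ, (∀ ω, 0 ≤ k ω) → IsIntegrable m k →
      (∀ᵐ ω ∂m.variation, |f ω * g ω| ≤ k ω) → MemLp m 1 (f * g) := by
    intro k k0 hk hle
    rw [MemLp, if_neg ENNReal.one_ne_top]
    refine ⟨hfm.mul hgm, hk.mono k0 (aesm_abs_rpow (hfm.mul hgm) _) ?_⟩
    filter_upwards [hle] with ω hω
    simpa using hω
  have bdd : ∀ k : Ω → ℝ, MeasureTheory.MemLp k ∞ m.variation →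
      ∃ C : ℝ, 0 ≤ C ∧ ∀ᵐ ω ∂m.variation, |k ω| ≤ C := by
    intro k hk
    refine ⟨(eLpNorm k ∞ m.variation).toReal, ENNReal.toReal_nonneg, ?_⟩
    have := ae_le_eLpNormEssSup (f := k) (μ := m.variation)
    filter_upwards [this] with ω hω
    rw [← Real.norm_eq_abs, ← toReal_enorm]
    exact ENNReal.toReal_mono hk.2.ne (by simpa using hω)
  by_cases h1 : p = ∞
  · have h2 : p' = 1 := by
      subst h1
      exact ENNReal.HolderConjugate.unique ∞ p' 1
    rw [MemLp, if_pos h1] at hf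
    rw [MemLp, if_neg (by simp [h2])] at hg
    obtain ⟨C, hC0, hC⟩ := bdd f hf
    refine red _ (fun ω => by positivity) (hg.2.const_mul C) ?_
    filter_upwards [hC] with ω hω
    simp only [h2, ENNReal.toReal_one, Real.rpow_one, abs_mul]
    gcongr
  by_cases h2 : p' = ∞
  · have h3 : p = 1 := by
      subst h2
      exact ENNReal.HolderConjugate.unique ∞ p 1
    rw [MemLp, if_pos h2] at hg
    rw [MemLp, if_neg h1] at hf
    obtain ⟨C, hC0, hC⟩ := bdd g hg
    refine red _ (fun ω => by positivity) (hf.2.const_mul C) ?_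
    filter_upwards [hC] with ω hω
    simp only [h3, ENNReal.toReal_one, Real.rpow_one, abs_mul]
    rw [mul_comm]
    gcongr
  · rw [MemLp, if_neg h1] at hf
    rw [MemLp, if_neg h2] at hg
    have hr : p.toReal.HolderConjugate p'.toReal := by
      have hp0 := ENNReal.HolderConjugate.ne_zero p p'
      have hp0' := ENNReal.HolderConjugate.ne_zero p' p
      have e := ENNReal.holderConjugate_iff.1 hpp
      have e2 := congrArg ENNReal.toReal e
      rw [ENNReal.toReal_add (by simpa using hp0) (by simpa using hp0'), ENNReal.toReal_inv,
        ENNReal.toReal_inv, ENNReal.toReal_one] at e2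
      have a1 := ENNReal.toReal_pos hp0 h1
      have a2 := ENNReal.toReal_pos hp0' h2
      refine Real.holderConjugate_iff.2 ⟨?_, e2⟩
      have : p.toReal⁻¹ < 1 := by linarith [inv_pos.2 a2]
      exact (inv_lt_one₀ a1).1 this
    refine red _ (fun ω => ?_) ((hf.2.const_mul (1 / p.toReal)).add
      (hg.2.const_mul (1 / p'.toReal))) (ae_of_all _ fun ω => ?_)
    · have := hr.nonneg
      have := hr.symm.nonneg
      positivity
    · have := Real.young_inequality_of_nonneg (abs_nonneg (f ω)) (abs_nonneg (g ω)) hr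
      rw [abs_mul]
      refine this.trans (le_of_eq ?_)
      ring

variable [CompleteSpace X]

lemma MemLp.add {m : VectorMeasure Ω X} {p : ℝ≥0∞} {f g : Ω → ℝ} (hf : MemLp m p f)
    (hg : MemLp m p g) : MemLp m p (f + g) := by
  have hfm := hf.aesm
  have hgm := hg.aesm
  unfold MemLp at *
  split_ifs at * with h
  · exact MeasureTheory.MemLp.add hf hg
  · refine ⟨hfm.add hgm, ?_⟩
    refine ((hf.2.add hg.2).const_mul (2 ^ p.toReal)).mono (fun ω => ?_)
      (aesm_abs_rpow (hfm.add hgm) _) (ae_of_all _ fun ω => ?_)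
    · positivity
    · rw [abs_of_nonneg (by positivity)]
      exact abs_add_rpow_le _ _ ENNReal.toReal_nonneg

end Integrals

/-! ### The spaces `L^p(m)` -/

section Spaces

variable {Ω X : Type*} [MeasurableSpace Ω] [NormedAddCommGroup X] [NormedSpace ℝ X]
  [CompleteSpace X]

/-- The space `L^p(m)`, `1 ≤ p ≤ ∞`, of classes (modulo `m`-null sets) of real functions. -/
noncomputable def Lp (m : VectorMeasure Ω X) (p : ℝ≥0∞) [hp : Fact (1 ≤ p)] :
    Submodule ℝ (Ω →ₘ[m.variation] ℝ) where
  carrier := {f | MemLp m p f}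
  zero_mem' := (MemLp.zero m hp.out).congr AEEqFun.coeFn_zero.symm
  add_mem' {f g} hf hg := (MemLp.add hf hg).congr (AEEqFun.coeFn_add f g).symm
  smul_mem' c f hf := (MemLp.const_smul hf c).congr (AEEqFun.coeFn_smul c f).symm

variable {m : VectorMeasure Ω X} {p p' : ℝ≥0∞} [hp : Fact (1 ≤ p)] [hp' : Fact (1 ≤ p')]

noncomputable instance : Norm (Lp m p) := ⟨fun f => (lpENorm m p (f : Ω →ₘ[m.variation] ℝ)).toReal⟩

lemma Lp.norm_def (f : Lp m p) :
    ‖f‖ = (lpENorm m p (f : Ω →ₘ[m.variation] ℝ)).toReal := rfl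

lemma Lp.normedSpaceCore (m : VectorMeasure Ω X) (p : ℝ≥0∞) [hp : Fact (1 ≤ p)] :
    NormedSpace.Core ℝ (Lp m p) where
  norm_nonneg f := ENNReal.toReal_nonneg
  norm_smul c f := by
    rw [Lp.norm_def, Submodule.coe_smul, lpENorm_congr (AEEqFun.coeFn_smul c _),
      lpENorm_const_smul m hp.out, ENNReal.toReal_mul, toReal_enorm, Lp.norm_def]
  norm_triangle f g := by
    simp only [Lp.norm_def]
    rw [Submodule.coe_add, lpENorm_congr (AEEqFun.coeFn_add _ _),
      ← ENNReal.toReal_add (MemLp.lpENorm_lt_top f.2).ne (MemLp.lpENorm_lt_top g.2).ne]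
    exact ENNReal.toReal_mono
      (ENNReal.add_ne_top.2 ⟨(MemLp.lpENorm_lt_top f.2).ne, (MemLp.lpENorm_lt_top g.2).ne⟩)
      (lpENorm_add_le hp.out (MemLp.aesm f.2) (MemLp.aesm g.2))
  norm_eq_zero_iff f := by
    constructor
    · intro h
      rw [Lp.norm_def, ENNReal.toReal_eq_zero_iff] at h
      have h := h.resolve_right (MemLp.lpENorm_lt_top f.2).ne
      have := ae_eq_zero_of_lpENorm hp.out (AEEqFun.stronglyMeasurable _) h
      exact Subtype.ext (AEEqFun.ext (this.trans AEEqFun.coeFn_zero.symm))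
    · rintro rfl
      have : lpENorm m p (0 : Ω → ℝ) = 0 := by
        simpa using lpENorm_const_smul m hp.out 0 (0 : Ω → ℝ)
      rw [Lp.norm_def, Submodule.coe_zero, lpENorm_congr AEEqFun.coeFn_zero, this]
      rfl

noncomputable instance : NormedAddCommGroup (Lp m p) := .ofCore (Lp.normedSpaceCore m p)

noncomputable instance : NormedSpace ℝ (Lp m p) := .ofCore (Lp.normedSpaceCore m p)

/-- The product `f g ∈ L^1(m)` of `f ∈ L^p(m)` and `g ∈ L^{p'}(m)`. -/
noncomputable def Lp.mul [p.HolderConjugate p'] (f : Lp m p) (g : Lp m p') : Lp m 1 :=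
  ⟨(f : Ω →ₘ[m.variation] ℝ) * (g : Ω →ₘ[m.variation] ℝ),
    (MemLp.mul (p := p) (p' := p') f.2 g.2).congr (AEEqFun.coeFn_mul _ _).symm⟩

lemma Lp.isIntegrable (f : Lp m 1) : IsIntegrable m (f : Ω →ₘ[m.variation] ℝ) := by
  have h : MemLp m 1 (f : Ω →ₘ[m.variation] ℝ) := f.2
  rw [MemLp, if_neg ENNReal.one_ne_top] at h
  exact h.2.mono (fun ω => by positivity) h.1 (ae_of_all _ fun ω => by simp)

/-- The integration map `I_m : L^1(m) → X`, `f ↦ ∫_Ω f dm`. -/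
noncomputable def Lp.integral (f : Lp m 1) : X :=
  ((Lp.isIntegrable f).exists_integral Set.univ MeasurableSet.univ).choose

/-- The defining property `⟨∫ f dm, x'⟩ = ∫ f d⟨m, x'⟩` of the integral. -/
lemma Lp.integral_spec (f : Lp m 1) (x' : StrongDual ℝ X) :
    x' (Lp.integral f) = ∫ᵛ ω, (f : Ω →ₘ[m.variation] ℝ) ω ∂<•(scalar m x') := by
  rw [← VectorMeasure.setIntegral_univ]
  exact ((Lp.isIntegrable f).exists_integral Set.univ MeasurableSet.univ).choose_spec x'

/-- The vector valued duality `B_m(f, g) = ∫ f g dm` between `L^p(m)` and `L^{p'}(m)`. -/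
noncomputable def pairing [p.HolderConjugate p'] (f : Lp m p) (g : Lp m p') : X :=
  Lp.integral (Lp.mul f g)

/-- The function `f ↦ sup_{g ∈ B_R} ‖∫ f g dm‖` given by a subspace `R ⊆ L^{p'}(m)`, where
`B_R = {g ∈ R : ‖g‖ ≤ 1}`. -/
noncomputable def normingFun [p.HolderConjugate p'] (R : Submodule ℝ (Lp m p')) (f : Lp m p) :
    ℝ≥0∞ :=
  ⨆ g ∈ Metric.closedBall (0 : R) 1, ‖pairing f (g : Lp m p')‖ₑ

/-- `R ⊆ L^{p'}(m)` is `m`-norming for `P ⊆ L^p(m)` (that is, `R` is an `m`-dual of `P`):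
`f ↦ sup_{g ∈ B_R} ‖∫ f g dm‖` is an equivalent norm on `P`. -/
def IsNorming [p.HolderConjugate p'] (P : Submodule ℝ (Lp m p)) (R : Submodule ℝ (Lp m p')) :
    Prop :=
  ∃ c C : ℝ≥0, 0 < c ∧ ∀ f : P,
    c * ‖f‖ₑ ≤ normingFun R (f : Lp m p) ∧ normingFun R (f : Lp m p) ≤ C * ‖f‖ₑ

/-- `(P, Pm, Pmm)` is an `m`-dual system: `Pm ⊆ L^{p'}(m)` is `m`-norming for `P ⊆ L^p(m)`, and
`Pmm ⊆ L^p(m)` contains `P` and is `m`-norming for `Pm`. -/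
structure IsDualSystem [p.HolderConjugate p'] (P : Submodule ℝ (Lp m p))
    (Pm : Submodule ℝ (Lp m p')) (Pmm : Submodule ℝ (Lp m p)) : Prop where
  norming : IsNorming P Pm
  le_bidual : P ≤ Pmm
  bidual_norming : IsNorming Pm Pmm

/-- The topology `τ_m(R)` on `P`, generated by the seminorms `f ↦ ‖∫ f g dm‖`, `g ∈ R`. Since
`f ↦ ∫ f g dm` is linear, it is the coarsest topology making all the maps `f ↦ ∫ f g dm ∈ X`,
`g ∈ R`, continuous for the norm of `X`. -/
noncomputable abbrev tauTopology [p.HolderConjugate p'] (P : Submodule ℝ (Lp m p))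
    (R : Submodule ℝ (Lp m p')) : TopologicalSpace P :=
  ⨅ g : R, TopologicalSpace.induced (fun f : P => pairing (f : Lp m p) (g : Lp m p')) inferInstance

/-- The closed unit ball `B_P` (for the norm of `L^p(m)`) is `τ_m(R)`-compact. -/
def IsTauCompactBall [p.HolderConjugate p'] (P : Submodule ℝ (Lp m p))
    (R : Submodule ℝ (Lp m p')) : Prop :=
  @IsCompact P (tauTopology P R) (Metric.closedBall (0 : P) 1)

variable {E : Type*} [NormedAddCommGroup E] [NormedSpace ℝ E]

/-- `T : P → E` is `(q, R)`-summing. -/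
def IsSumming [p.HolderConjugate p'] {P : Submodule ℝ (Lp m p)} (q : ℝ)
    (R : Submodule ℝ (Lp m p')) (T : P →L[ℝ] E) : Prop :=
  ∃ K : ℝ≥0, ∀ (n : ℕ) (f : Fin n → P),
    (∑ i, ‖T (f i)‖ₑ ^ q) ^ (1 / q) ≤
      K * ⨆ g ∈ Metric.closedBall (0 : R) 1,
        (∑ i, ‖pairing (f i : Lp m p) (g : Lp m p')‖ₑ ^ q) ^ (1 / q)

/-- `T : P → E` is `τ_m(R)`-sequentially completely continuous: `‖T f_n‖ → 0` for every bounded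
sequence `(f_n)` in `P` such that `‖∫ f_n h dm‖ → 0` for every `h ∈ R`. -/
def IsTauSeqCompletelyContinuous [p.HolderConjugate p'] {P : Submodule ℝ (Lp m p)}
    (R : Submodule ℝ (Lp m p')) (T : P →L[ℝ] E) : Prop :=
  ∀ f : ℕ → P, (∃ C : ℝ, ∀ n, ‖f n‖ ≤ C) →
    (∀ h : R, Tendsto (fun n => ‖pairing (f n : Lp m p) (h : Lp m p')‖) atTop (𝓝 0)) →
    Tendsto (fun n => ‖T (f n)‖) atTop (𝓝 0)

end Spaces

section Operators

variable {F E : Type*} [NormedAddCommGroup F] [NormedSpace ℝ F] [NormedAddCommGroup E]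
  [NormedSpace ℝ E]

/-- `T` is completely continuous: it maps weakly convergent sequences to norm convergent ones. -/
def IsCompletelyContinuous (T : F →L[ℝ] E) : Prop :=
  ∀ (f : ℕ → F) (f₀ : F),
    Tendsto (fun n => toWeakSpace ℝ F (f n)) atTop (𝓝 (toWeakSpace ℝ F f₀)) →
    Tendsto (fun n => T (f n)) atTop (𝓝 (T f₀))

/-- `T` is weakly compact: the image of the unit ball is relatively weakly compact. -/
def IsWeaklyCompact (T : F →L[ℝ] E) : Prop :=
  IsCompact (closure (toWeakSpace ℝ E '' (T '' Metric.closedBall 0 1)))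

/-- `F` is reflexive: the canonical embedding into the bidual is onto. -/
def IsReflexive (F : Type*) [NormedAddCommGroup F] [NormedSpace ℝ F] : Prop :=
  Function.Surjective (NormedSpace.inclusionInDoubleDual ℝ F)

end Operators

end VecLp

namespace VecLp

/-- A convex set of continuous functions on a compact space, none of which is everywhere negative,
has nonnegative integrals against some probability measure. -/
theorem exists_probabilityMeasure_integral_nonneg {S : Type*} [TopologicalSpace S] [CompactSpace S]
    [T2Space S] [MeasurableSpace S] [BorelSpace S] {C : Set C(S, ℝ)}
    (hC : Convex ℝ C) (hne : C.Nonempty) (h : ∀ F ∈ C, ∃ s, 0 ≤ F s) :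
    ∃ μ : Measure S, IsProbabilityMeasure μ ∧ μ.Regular ∧ ∀ F ∈ C, 0 ≤ ∫ s, F s ∂μ := by
  obtain ⟨F₀, hF₀⟩ := hne
  obtain ⟨s₀, hs₀⟩ := h F₀ hF₀
  have : Nonempty S := ⟨s₀⟩
  let V : Set C(S, ℝ) := {F | ∀ s, F s < 0}
  have hVo : IsOpen V := by
    have := ContinuousMap.isOpen_setOfPred_mapsTo (X := S) (Y := ℝ) isCompact_univ isOpen_Iio (U := Set.Iio 0)
    convert this using 1
    ext F
    simp [V, Set.MapsTo]
  have hVc : Convex ℝ V := by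
    intro F hF G hG a b ha hb hab s
    have h1 := hF s
    have h2 := hG s
    change a * F s + b * G s < 0
    rcases ha.eq_or_lt with rfl | ha
    · have : b = 1 := by linarith
      subst this; linarith
    · nlinarith
  have hd : Disjoint V C := Set.disjoint_left.2 fun F hF hFC => by
    obtain ⟨s, hs⟩ := h F hFC
    exact absurd (hF s) (not_lt.2 hs)
  obtain ⟨f, u, h1, h2⟩ := geometric_hahn_banach_open hVc hVo hC hd
  have hV0 : ∀ F ∈ V, f F ≤ 0 := by
    intro F hF
    by_contra! hlt
    obtain ⟨n, hn⟩ := exists_nat_gt (u / f F)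
    have hm : ((n : ℝ) + 1) • F ∈ V := fun s => by
      have := hF s
      change ((n : ℝ) + 1) * F s < 0
      nlinarith [(Nat.cast_nonneg n : (0 : ℝ) ≤ n)]
    have := h1 _ hm
    rw [map_smul, smul_eq_mul] at this
    rw [div_lt_iff₀ hlt] at hn
    nlinarith
  have hpos : ∀ F : C(S, ℝ), (∀ s, 0 ≤ F s) → 0 ≤ f F := by
    intro F hF
    have key : ∀ ε : ℝ, 0 < ε → 0 ≤ f F + ε * f 1 := by
      intro ε hε
      have := hV0 (-(F + ε • 1)) fun s => by
        have := hF s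
        change -(F s + ε * 1) < 0
        linarith
      rw [map_neg, map_add, map_smul, smul_eq_mul] at this
      linarith
    by_contra! hlt
    rcases le_or_gt (f 1) 0 with h0 | h0
    · have := key 1 one_pos
      linarith
    · have := key (-(f F) / (2 * f 1)) (by apply div_pos <;> linarith)
      have e : -(f F) / (2 * f 1) * f 1 = - f F / 2 := by field_simp
      rw [e] at this
      linarith
  have hone : 0 < f 1 := by
    refine (hpos 1 fun s => zero_le_one).lt_of_ne fun h0 => ?_
    have hz : ∀ F : C(S, ℝ), 0 ≤ f F := by
      intro F
      have := hpos (F + ‖F‖ • 1) fun s => by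
        have := F.norm_coe_le_norm s
        rw [Real.norm_eq_abs, abs_le] at this
        change 0 ≤ F s + ‖F‖ * 1
        linarith
      rw [map_add, map_smul, ← h0, smul_zero, add_zero] at this
      exact this
    have a1 := h1 (-1) fun s => by simp
    have a2 := h2 _ hF₀
    have a3 := hz (-F₀)
    rw [map_neg] at a1 a3
    rw [← h0] at a1
    linarith
  let Λ : CompactlySupportedContinuousMap S ℝ →ₚ[ℝ] ℝ := PositiveLinearMap.mk₀
    { toFun := fun F => (f 1)⁻¹ * f F.toContinuousMap
      map_add' := fun F G => by
        rw [← mul_add, ← map_add]; rfl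
      map_smul' := fun c F => by
        have : f (c • F).toContinuousMap = c * f F.toContinuousMap := by
          rw [← smul_eq_mul, ← map_smul]; rfl
        rw [this, RingHom.id_apply, smul_eq_mul]; ring }
    fun F hF => mul_nonneg (inv_nonneg.2 hone.le) (hpos _ fun s => hF s)
  have hint : ∀ F : C(S, ℝ), ∫ s, F s ∂(RealRMK.rieszMeasure Λ) = (f 1)⁻¹ * f F := fun F =>
    RealRMK.integral_rieszMeasure Λ (CompactlySupportedContinuousMap.continuousMapEquiv F)
  refine ⟨RealRMK.rieszMeasure Λ, ?_, inferInstance, fun F hF => ?_⟩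
  · have := hint 1
    rw [inv_mul_cancel₀ hone.ne'] at this
    simp only [ContinuousMap.one_apply, integral_const, smul_eq_mul, mul_one] at this
    constructor
    rw [← ENNReal.toReal_eq_one_iff]
    exact this
  · rw [hint]
    refine mul_nonneg (inv_nonneg.2 hone.le) (le_trans ?_ (h2 F hF))
    by_contra! hu
    have a1 : ∀ ε : ℝ, 0 < ε → ε * f (-1) < u := fun ε hε => by
      rw [← smul_eq_mul, ← map_smul]
      refine h1 _ fun s => ?_
      change ε * (-1) < 0
      linarith
    rw [map_neg] at a1
    have := a1 (-u / f 1) (by apply div_pos <;> linarith)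
    have e : -u / f 1 * -f 1 = u := by field_simp
    linarith

/-- A bounded sequence in an inner product space has a Cauchy sequence of forward convex blocks. -/
theorem exists_cauchySeq_convexHull_of_inner {H : Type*} [NormedAddCommGroup H]
    [InnerProductSpace ℝ H] (h : ℕ → H) {M : ℝ} (hM : ∀ n, ‖h n‖ ≤ M) :
    ∃ z : ℕ → H, (∀ n, z n ∈ convexHull ℝ (h '' Set.Ici n)) ∧ CauchySeq z := by
  let C : ℕ → Set H := fun n => convexHull ℝ (h '' Set.Ici n)
  have hCanti : Antitone C := fun a b hab => convexHull_mono (Set.image_mono (Set.Ici_subset_Ici.2 hab))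
  have hne : ∀ n, h n ∈ C n := fun n => subset_convexHull _ _ ⟨n, Set.self_mem_Ici, rfl⟩
  let d : ℕ → ℝ := fun n => sInf ((fun z => ‖z‖) '' C n)
  have hbdd : ∀ n, BddBelow ((fun z => ‖z‖) '' C n) := fun n =>
    ⟨0, by rintro _ ⟨z, -, rfl⟩; exact norm_nonneg z⟩
  have hd : ∀ n, ∀ z ∈ C n, d n ≤ ‖z‖ := fun n z hz => csInf_le (hbdd n) ⟨z, hz, rfl⟩
  have hd0 : ∀ n, 0 ≤ d n := fun n => Real.sInf_nonneg (by rintro _ ⟨z, -, rfl⟩; exact norm_nonneg z)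
  have hdm : Monotone d := fun a b hab =>
    csInf_le_csInf (hbdd a) ⟨_, h b, hne b, rfl⟩ (Set.image_mono (hCanti hab))
  have hdM : ∀ n, d n ≤ M := fun n => (hd n _ (hne n)).trans (hM n)
  have hex : ∀ n : ℕ, ∃ z ∈ C n, ‖z‖ < d n + 1 / ((n : ℝ) + 1) := by
    intro n
    obtain ⟨_, ⟨z, hz, rfl⟩, hlt⟩ := exists_lt_of_csInf_lt
      (s := (fun z => ‖z‖) '' C n) ⟨_, h n, hne n, rfl⟩
      (lt_add_of_pos_right (d n) (by positivity : (0 : ℝ) < 1 / ((n : ℝ) + 1)))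
    exact ⟨z, hz, hlt⟩
  choose z hz hzlt using hex
  refine ⟨z, hz, ?_⟩
  have hlim : Tendsto d atTop (𝓝 (⨆ n, d n)) :=
    tendsto_atTop_ciSup hdm ⟨M, by rintro _ ⟨n, rfl⟩; exact hdM n⟩
  have hle : ∀ n, d n ≤ ⨆ n, d n := fun n => le_ciSup ⟨M, by rintro _ ⟨n, rfl⟩; exact hdM n⟩ n
  set D := ⨆ n, d n
  let b : ℕ → ℝ := fun n => √(4 * (D + 1 / ((n : ℝ) + 1)) ^ 2 - 4 * d n ^ 2)
  have hb : Tendsto b atTop (𝓝 0) := by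
    have h1 : Tendsto (fun n : ℕ => 4 * (D + 1 / ((n : ℝ) + 1)) ^ 2 - 4 * d n ^ 2) atTop
        (𝓝 (4 * (D + 0) ^ 2 - 4 * D ^ 2)) :=
      (((tendsto_one_div_add_atTop_nhds_zero_nat.const_add D).pow 2).const_mul 4).sub
        ((hlim.pow 2).const_mul 4)
    have := (Real.continuous_sqrt.tendsto _).comp h1
    simpa [b, Function.comp_def] using this
  refine cauchySeq_of_le_tendsto_0' b (fun n k hnk => ?_) hb
  rw [dist_eq_norm]
  refine Real.le_sqrt_of_sq_le ?_
  have mid : (1 / 2 : ℝ) • z n + (1 / 2 : ℝ) • z k ∈ C n :=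
    (convex_convexHull ℝ _) (hz n) (hCanti hnk (hz k)) (by norm_num) (by norm_num) (by norm_num)
  have hmid := hd n _ mid
  rw [← smul_add, norm_smul] at hmid
  norm_num at hmid
  have par := parallelogram_law_with_norm ℝ (z n) (z k)
  have b1 : ‖z n‖ ≤ D + 1 / ((n : ℝ) + 1) := (hzlt n).le.trans (by gcongr; exact hle n)
  have b2 : ‖z k‖ ≤ D + 1 / ((n : ℝ) + 1) := (hzlt k).le.trans (by gcongr; exact hle k)
  have := hd0 n
  have e1 : ‖z n‖ ^ 2 ≤ (D + 1 / ((n : ℝ) + 1)) ^ 2 := by gcongr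
  have e2 : ‖z k‖ ^ 2 ≤ (D + 1 / ((n : ℝ) + 1)) ^ 2 := by gcongr
  have e3 : (2 * d n) ^ 2 ≤ ‖z n + z k‖ ^ 2 := by gcongr; linarith
  nlinarith

/-- A functional on the dual far from the canonical image of `E` is large at some functional of
norm at most one vanishing on given finitely many vectors. -/
theorem exists_dual_eq_zero_of_dist_bidual {E : Type*} [NormedAddCommGroup E] [NormedSpace ℝ E]
    (φ : StrongDual ℝ (StrongDual ℝ E)) {θ : ℝ} (hθ : 0 ≤ θ)
    (hφ : ∀ e, θ < ‖φ - NormedSpace.inclusionInDoubleDual ℝ E e‖) (s : Finset E) :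
    ∃ l : StrongDual ℝ E, ‖l‖ ≤ 1 ∧ (∀ a ∈ s, l a = 0) ∧ θ < φ l := by
  by_contra! hcon
  let L : s → StrongDual ℝ E →ₗ[ℝ] ℝ := fun a =>
    (NormedSpace.inclusionInDoubleDual ℝ E a : StrongDual ℝ E →ₗ[ℝ] ℝ)
  let W : Submodule ℝ (StrongDual ℝ E) := ⨅ i, LinearMap.ker (L i)
  have hW : ∀ l ∈ W, ∀ a ∈ s, l a = 0 := fun l hl a ha => by
    have := (Submodule.mem_iInf _).1 hl ⟨a, ha⟩
    exact this
  have hle : ∀ l ∈ W, φ l ≤ θ * ‖l‖ := by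
    intro l hl
    rcases eq_or_ne l 0 with rfl | h0
    · simp
    have hn : 0 < ‖l‖ := norm_pos_iff.2 h0
    have := hcon (‖l‖⁻¹ • l) (by rw [norm_smul, norm_inv, norm_norm, inv_mul_cancel₀ hn.ne'])
      (fun a ha => by simp [hW l hl a ha])
    rw [map_smul, smul_eq_mul, inv_mul_le_iff₀ hn] at this
    linarith
  obtain ⟨g, hg, hgn⟩ := exists_extension_norm_eq W (φ.comp W.subtypeL)
  have hgθ : ‖g‖ ≤ θ := by
    rw [hgn]
    refine ContinuousLinearMap.opNorm_le_bound _ hθ fun l => ?_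
    rw [Real.norm_eq_abs, abs_le']
    refine ⟨hle l l.2, ?_⟩
    have := hle (-l) (W.neg_mem l.2)
    rwa [norm_neg, map_neg] at this
  have hspan : ((φ - g : StrongDual ℝ (StrongDual ℝ E)) : StrongDual ℝ E →ₗ[ℝ] ℝ) ∈
      Submodule.span ℝ (Set.range L) := by
    refine mem_span_of_iInf_ker_le_ker fun l hl => ?_
    have := hg ⟨l, hl⟩
    change φ l - g l = 0
    rw [this]
    exact sub_self _
  obtain ⟨c, hc⟩ := (Submodule.mem_span_range_iff_exists_fun ℝ).1 hspan
  have he : φ - NormedSpace.inclusionInDoubleDual ℝ E (∑ i, c i • (i : E)) = g := by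
    ext l
    have := LinearMap.congr_fun hc l
    simp only [LinearMap.sum_apply, LinearMap.smul_apply] at this
    change _ = φ l - g l at this
    rw [sub_apply, map_sum, sum_apply]
    simp only [map_smul, smul_apply]
    change φ l - ∑ i, c i • L i l = g l
    linarith
  have := hφ (∑ i, c i • (i : E))
  rw [he] at this
  linarith

/-- A bounded set in which every sequence has norm Cauchy forward convex blocks is relatively
weakly compact. -/
theorem isCompact_closure_toWeakSpace_image {E : Type*} [NormedAddCommGroup E] [NormedSpace ℝ E]
    [CompleteSpace E] {A : Set E} (hA : Bornology.IsBounded A)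
    (h : ∀ a : ℕ → E, (∀ n, a n ∈ A) →
      ∃ y : ℕ → E, (∀ n, y n ∈ convexHull ℝ (a '' Set.Ici n)) ∧ CauchySeq y) :
    IsCompact (closure (toWeakSpace ℝ E '' A)) := by
  refine NormedSpace.isCompact_closure_of_isBounded ℝ E _
    (by rwa [Set.preimage_image_eq _ (toWeakSpace ℝ E).injective]) fun φ' hφ' => ?_
  by_contra hnot
  let φ : StrongDual ℝ (StrongDual ℝ E) := WeakDual.toStrongDual φ'
  have hclosed : IsClosed (Set.range (NormedSpace.inclusionInDoubleDual ℝ E)) := by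
    have hi := (NormedSpace.inclusionInDoubleDualLi (𝕜 := ℝ) (E := E)).isometry
    exact hi.isUniformInducing.isComplete_range.isClosed
  have hφn : φ ∉ Set.range (NormedSpace.inclusionInDoubleDual ℝ E) := by
    rintro ⟨e, he⟩
    exact hnot ⟨toWeakSpace ℝ E e, congrArg StrongDual.toWeakDual he⟩
  obtain ⟨δ, hδ, hball⟩ := Metric.isOpen_iff.1 hclosed.isOpen_compl φ hφn
  have hdist : ∀ e, δ / 2 < ‖φ - NormedSpace.inclusionInDoubleDual ℝ E e‖ := by
    intro e
    by_contra! hle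
    refine hball (a := NormedSpace.inclusionInDoubleDual ℝ E e) ?_ ⟨e, rfl⟩
    rw [Metric.mem_ball']
    exact (dist_eq_norm φ _).trans_lt (by linarith)
  set θ := δ / 2 with hθ
  have hθ0 : 0 < θ := by positivity
  have approx : ∀ s : Finset (StrongDual ℝ E), (∀ l ∈ s, θ < φ l) → ∃ a ∈ A, ∀ l ∈ s, θ < l a := by
    intro s hs
    have ho : IsOpen {ψ : WeakDual ℝ (StrongDual ℝ E) | ∀ l ∈ s, θ < ψ l} := by
      have : {ψ : WeakDual ℝ (StrongDual ℝ E) | ∀ l ∈ s, θ < ψ l} =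
          ⋂ l ∈ s, {ψ : WeakDual ℝ (StrongDual ℝ E) | θ < ψ l} := by ext; simp
      rw [this]
      exact isOpen_biInter_finset fun l _ =>
        isOpen_lt continuous_const (WeakDual.eval_continuous l)
    obtain ⟨_, hψ, _, ⟨a, ha, rfl⟩, rfl⟩ := mem_closure_iff.1 hφ' _ ho hs
    exact ⟨a, ha, hψ⟩
  obtain ⟨f, hf1, hf2⟩ := exists_seq_of_forall_finset_exists
    (P := fun x : E × StrongDual ℝ E => x.1 ∈ A ∧ ‖x.2‖ ≤ 1 ∧ θ < φ x.2 ∧ θ < x.2 x.1)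
    (r := fun x y => y.2 x.1 = 0 ∧ θ < x.2 y.1) (fun s hs => by
      classical
      obtain ⟨l, hl1, hl2, hl3⟩ :=
        exists_dual_eq_zero_of_dist_bidual φ hθ0.le hdist (s.image Prod.fst)
      obtain ⟨a, ha, hal⟩ := approx (insert l (s.image Prod.snd)) (by
        intro k hk
        rcases Finset.mem_insert.1 hk with rfl | hk
        · exact hl3
        · obtain ⟨x, hx, rfl⟩ := Finset.mem_image.1 hk
          exact (hs x hx).2.2.1)
      refine ⟨(a, l), ⟨ha, hl1, hl3, hal l (Finset.mem_insert_self _ _)⟩, fun x hx => ⟨?_, ?_⟩⟩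
      · exact hl2 _ (Finset.mem_image_of_mem _ hx)
      · exact hal _ (Finset.mem_insert_of_mem (Finset.mem_image_of_mem _ hx)))
  obtain ⟨y, hy, hyc⟩ := h (fun n => (f n).1) fun n => (hf1 n).1
  have big : ∀ k n, k ≤ n → θ < (f k).2 (y n) := by
    intro k n hkn
    have hc : Convex ℝ {x : E | θ < (f k).2 x} :=
      convex_halfSpace_gt (f k).2.toLinearMap.isLinear θ
    refine convexHull_min ?_ hc (hy n)
    rintro _ ⟨j, hj, rfl⟩
    rcases (hkn.trans hj).eq_or_lt with rfl | hlt
    · exact (hf1 k).2.2.2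
    · exact (hf2 k j hlt).2
  have small : ∀ n, ∃ N, ∀ k ≥ N, (f k).2 (y n) = 0 := by
    intro n
    let V : Submodule ℝ E :=
      { carrier := {x | ∃ N, ∀ k ≥ N, (f k).2 x = 0}
        zero_mem' := ⟨0, fun k _ => map_zero _⟩
        add_mem' := by
          rintro a b ⟨N, hN⟩ ⟨N', hN'⟩
          refine ⟨max N N', fun k hk => ?_⟩
          rw [map_add, hN k (le_of_max_le_left hk), hN' k (le_of_max_le_right hk), add_zero]
        smul_mem' := by
          rintro c a ⟨N, hN⟩
          exact ⟨N, fun k hk => by rw [map_smul, hN k hk, smul_zero]⟩ }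
    refine (convexHull_min ?_ V.convex (hy n) : y n ∈ V)
    rintro _ ⟨j, -, rfl⟩
    exact ⟨j + 1, fun k hk => (hf2 j k hk).1⟩
  obtain ⟨n, hn⟩ := Metric.cauchySeq_iff'.1 hyc θ hθ0
  obtain ⟨N, hN⟩ := small n
  have h1 := big (max n N) (max n N) le_rfl
  have h2 := hN (max n N) (le_max_right _ _)
  have h3 := hn (max n N) (le_max_left _ _)
  have h4 : (f (max n N)).2 (y (max n N) - y n) ≤ ‖y (max n N) - y n‖ :=
    (le_abs_self _).trans (((f (max n N)).2.le_of_opNorm_le (hf1 _).2.1 _).trans (one_mul _).le)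
  rw [map_sub, h2, sub_zero] at h4
  rw [dist_eq_norm] at h3
  linarith

/-- In a reflexive space, a bounded sequence in a closed subspace which converges against a
family of functionals separating the points of that subspace is weakly convergent there. -/
theorem exists_tendsto_dual_of_separating {X ι : Type*} [NormedAddCommGroup X] [NormedSpace ℝ X]
    (hX : IsReflexive X) {X₀ : Submodule ℝ X} (hX₀ : IsClosed (X₀ : Set X))
    {D : ι → StrongDual ℝ X} (hD : ∀ x ∈ X₀, (∀ i, D i x = 0) → x = 0)
    {a : ℕ → X} (ha : ∀ n, a n ∈ X₀) {M : ℝ} (hM : ∀ n, ‖a n‖ ≤ M)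
    (hc : ∀ i, ∃ r, Tendsto (fun n => D i (a n)) atTop (𝓝 r)) :
    ∃ w ∈ X₀, ∀ l : StrongDual ℝ X, Tendsto (fun n => l (a n)) atTop (𝓝 (l w)) := by
  choose r hr using hc
  have key : ∀ U : Ultrafilter ℕ, (U : Filter ℕ) ≤ atTop →
      ∃ w ∈ X₀, (∀ l : StrongDual ℝ X, Tendsto (fun n => l (a n)) U (𝓝 (l w))) ∧
        ∀ i, D i w = r i := by
    intro U hU
    let b : ℕ → WeakDual ℝ (StrongDual ℝ X) := fun n =>
      StrongDual.toWeakDual (NormedSpace.inclusionInDoubleDual ℝ X (a n))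
    have hb : ((U.map b : Ultrafilter _) : Filter (WeakDual ℝ (StrongDual ℝ X))) ≤
        𝓟 (WeakDual.toStrongDual ⁻¹' Metric.closedBall 0 M) := by
      rw [le_principal_iff]
      refine Filter.mem_map.2 (Filter.univ_mem' fun n => ?_)
      exact (mem_closedBall_zero_iff (a := NormedSpace.inclusionInDoubleDual ℝ X (a n))).2
        ((NormedSpace.double_dual_bound ℝ X (a n)).trans (hM n))
    obtain ⟨φ, -, hφ⟩ := (WeakDual.isCompact_closedBall (0 : StrongDual ℝ (StrongDual ℝ X))
      M).ultrafilter_le_nhds _ hb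
    obtain ⟨w, hw⟩ := hX (WeakDual.toStrongDual φ)
    have ht : ∀ l : StrongDual ℝ X, Tendsto (fun n => l (a n)) U (𝓝 (l w)) := by
      intro l
      have h1 : Tendsto b U (𝓝 φ) := hφ
      have h2 := ((WeakDual.eval_continuous l).tendsto φ).comp h1
      have h3 : φ l = l w := (congrArg (fun ψ : StrongDual ℝ (StrongDual ℝ X) => ψ l) hw).symm
      rw [← h3]
      exact h2
    refine ⟨w, ?_, ht, fun i => tendsto_nhds_unique (ht (D i)) ((hr i).mono_left hU)⟩
    by_contra hwn
    obtain ⟨l, u, h1, h2⟩ := geometric_hahn_banach_point_closed X₀.convex hX₀ hwn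
    have h3 : u ≤ l w := ge_of_tendsto (ht l) (Filter.Eventually.of_forall fun n => (h2 _ (ha n)).le)
    linarith
  obtain ⟨w, hw, -, hwr⟩ := key (Filter.hyperfilter ℕ) (by
    rw [← Nat.cofinite_eq_atTop]; exact Filter.hyperfilter_le_cofinite)
  refine ⟨w, hw, fun l => ?_⟩
  rw [tendsto_iff_ultrafilter]
  intro U hU
  obtain ⟨w', hw', ht, hwr'⟩ := key U hU
  have : w' - w = 0 := hD _ (X₀.sub_mem hw' hw) fun i => by rw [map_sub, hwr, hwr', sub_self]
  rw [← sub_eq_zero.1 this]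
  exact ht l

/-- If a regular measure `μ` on `S` integrates functions of the form `φ ∘ π` like `η`, then the
image of `μ` under `π` is dominated by `η`. -/
theorem map_le_of_integral_comp_eq {S K : Type*} [TopologicalSpace S] [CompactSpace S]
    [T2Space S] [MeasurableSpace S] [BorelSpace S] [TopologicalSpace K] [CompactSpace K]
    [T2Space K] [MeasurableSpace K] [BorelSpace K] {π : S → K} (hπ : Continuous π)
    {μ : Measure S} [IsFiniteMeasure μ] [μ.Regular] {η : Measure K} [IsFiniteMeasure η] [η.Regular]
    (h : ∀ φ : C(K, ℝ), ∫ s, φ (π s) ∂μ = ∫ g, φ g ∂η) : μ.map π ≤ η := by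
  have hopen : ∀ V : Set K, IsOpen V → μ (π ⁻¹' V) ≤ η V := by
    intro V hV
    rw [(hV.preimage hπ).measure_eq_iSup_isCompact]
    refine iSup₂_le fun Q hQ => iSup_le fun hQc => ?_
    obtain ⟨φ, h0, h1, h2⟩ := exists_continuous_zero_one_of_isClosed hV.isClosed_compl
      (hQc.image hπ).isClosed (Set.disjoint_left.2 fun x hx hx' => by
        obtain ⟨s, hs, rfl⟩ := hx'
        exact hx (hQ hs))
    have i1 : Integrable (fun s => φ (π s)) μ :=
      (φ.continuous.comp hπ).integrable_of_hasCompactSupport (HasCompactSupport.of_compactSpace _)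
    have i2 : Integrable φ η :=
      φ.continuous.integrable_of_hasCompactSupport (HasCompactSupport.of_compactSpace _)
    have e1 : μ.real Q ≤ ∫ s, φ (π s) ∂μ := by
      rw [← integral_indicator_one hQc.measurableSet]
      refine integral_mono ((integrable_indicator_iff hQc.measurableSet).2
        (integrable_const _).integrableOn) i1 fun s => ?_
      by_cases hs : s ∈ Q
      · simp [hs, h1 ⟨s, hs, rfl⟩]
      · simpa [hs] using (h2 (π s)).1
    have e2 : ∫ g, φ g ∂η ≤ η.real V := by
      rw [← integral_indicator_one hV.measurableSet]
      refine integral_mono i2 ((integrable_indicator_iff hV.measurableSet).2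
        (integrable_const _).integrableOn) fun g => ?_
      by_cases hg : g ∈ V
      · simpa [hg] using (h2 g).2
      · simp [hg, h0 hg]
    rw [h] at e1
    exact (ENNReal.toReal_le_toReal (measure_ne_top _ _) (measure_ne_top _ _)).1 (e1.trans e2)
  refine Measure.le_iff.2 fun B hB => ?_
  rw [Measure.map_apply hπ.measurable hB, B.measure_eq_iInf_isOpen]
  exact le_iInf₂ fun V hBV => le_iInf fun hV =>
    (measure_mono (Set.preimage_mono hBV)).trans (hopen V hV)

/-- The closed unit ball of the dual, with the weak-* topology. -/
abbrev DualBall (X : Type*) [NormedAddCommGroup X] [NormedSpace ℝ X] : Type _ :=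
  ↥((WeakDual.toStrongDual : WeakDual ℝ X → StrongDual ℝ X) ⁻¹'
    Metric.closedBall (0 : StrongDual ℝ X) 1)

section DualBall

variable {X : Type*} [NormedAddCommGroup X] [NormedSpace ℝ X]

instance : CompactSpace (DualBall X) :=
  isCompact_iff_compactSpace.1 (WeakDual.isCompact_closedBall (0 : StrongDual ℝ X) 1)

lemma DualBall.abs_apply_le (l : DualBall X) (x : X) : |l.1 x| ≤ ‖x‖ := by
  have h : ‖WeakDual.toStrongDual l.1‖ ≤ 1 := mem_closedBall_zero_iff.1 l.2
  exact ((WeakDual.toStrongDual l.1).le_of_opNorm_le h x).trans (one_mul _).le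

lemma DualBall.exists_apply_eq_norm (x : X) : ∃ l : DualBall X, l.1 x = ‖x‖ := by
  obtain ⟨l, hl, hx⟩ := exists_dual_vector'' ℝ x
  exact ⟨⟨StrongDual.toWeakDual l, (mem_closedBall_zero_iff (a := l)).2 hl⟩, hx⟩

lemma DualBall.continuous_apply : Continuous fun z : X × DualBall X => z.2.1 z.1 := by
  refine continuous_prod_of_continuous_lipschitzWith _ 1
    (fun x => (WeakDual.eval_continuous x).comp continuous_subtype_val) fun l => ?_
  refine LipschitzWith.of_dist_le_mul fun x y => ?_
  rw [NNReal.coe_one, one_mul, dist_eq_norm, dist_eq_norm, Real.norm_eq_abs, ← map_sub]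
  exact l.abs_apply_le _

end DualBall

lemma ContinuousMap.integrable_of_compactSpace {K X : Type*} [TopologicalSpace K] [CompactSpace K]
    [MeasurableSpace K] [BorelSpace K] [NormedAddCommGroup X] (η : Measure K) [IsFiniteMeasure η]
    (f : C(K, X)) : Integrable f η :=
  f.continuous.integrable_of_hasCompactSupport (HasCompactSupport.of_compactSpace _)

/-- Mazur's lemma in `L^1(η; X)` for bounded sequences of continuous functions converging weakly
almost everywhere. -/
theorem exists_convexHull_integral_norm_sub_lt {K X : Type*} [TopologicalSpace K] [CompactSpace K]
    [T2Space K] [MeasurableSpace K] [BorelSpace K] [NormedAddCommGroup X] [NormedSpace ℝ X]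
    {η : Measure K} [IsProbabilityMeasure η] [η.Regular] {v : ℕ → C(K, X)} {M : ℝ}
    (hM : ∀ n, ‖v n‖ ≤ M) {w : K → X} (hw : Integrable w η)
    (hv : ∀ᵐ g ∂η, ∀ l : StrongDual ℝ X, Tendsto (fun n => l (v n g)) atTop (𝓝 (l (w g))))
    {ε : ℝ} (hε : 0 < ε) (N : ℕ) :
    ∃ y ∈ convexHull ℝ (v '' Set.Ici N), ∫ g, ‖y g - w g‖ ∂η < ε := by
  by_contra! hcon
  obtain ⟨c', hc', -⟩ := hw.exists_boundedContinuous_integral_sub_le (ε := ε / 4) (by positivity)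
  let c : C(K, X) := c'.toContinuousMap
  replace hc' : ∫ g, ‖w g - c g‖ ∂η ≤ ε / 4 := hc'
  have ci := ContinuousMap.integrable_of_compactSpace η c
  have hyc : ∀ y ∈ convexHull ℝ (v '' Set.Ici N), 3 * (ε / 4) ≤ ∫ g, ‖y g - c g‖ ∂η := by
    intro y hy
    have yi := ContinuousMap.integrable_of_compactSpace η y
    have h1 : ∫ g, ‖y g - w g‖ ∂η ≤ ∫ g, (‖y g - c g‖ + ‖w g - c g‖) ∂η := by
      refine integral_mono (yi.sub hw).norm ((yi.sub ci).norm.add (hw.sub ci).norm) fun g => ?_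
      have := norm_sub_le (y g - c g) (w g - c g)
      rwa [sub_sub_sub_cancel_right] at this
    have h2 : ∫ g, (‖y g - c g‖ + ‖w g - c g‖) ∂η = _ :=
      integral_add (yi.sub ci).norm (hw.sub ci).norm
    linarith [hcon y hy]
  let S := K × DualBall X
  let : MeasurableSpace S := borel S
  have : BorelSpace S := ⟨rfl⟩
  let F : C(K, X) → C(S, ℝ) := fun y =>
    ⟨fun s => s.2.1 (y s.1), DualBall.continuous_apply.comp
      ((y.continuous.comp continuous_fst).prodMk continuous_snd)⟩
  let C : Set C(S, ℝ) := {G | ∃ y ∈ convexHull ℝ (v '' Set.Ici N), ∃ φ : C(K, ℝ), ∀ s,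
    G s = F (y - c) s - 2 * (ε / 4) + (φ s.1 - ∫ g, φ g ∂η)}
  have hvN : v N ∈ convexHull ℝ (v '' Set.Ici N) :=
    subset_convexHull _ _ ⟨N, Set.self_mem_Ici, rfl⟩
  let G : C(K, X) → C(K, ℝ) → C(S, ℝ) := fun y φ =>
    F (y - c) - ContinuousMap.const _ (2 * (ε / 4)) +
      (φ.comp ⟨Prod.fst, continuous_fst⟩ - ContinuousMap.const _ (∫ g, φ g ∂η))
  have hG : ∀ y ∈ convexHull ℝ (v '' Set.Ici N), ∀ φ, G y φ ∈ C := fun y hy φ =>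
    ⟨y, hy, φ, fun s => rfl⟩
  have hCc : Convex ℝ C := by
    rintro G₁ ⟨y₁, hy₁, φ₁, h₁⟩ G₂ ⟨y₂, hy₂, φ₂, h₂⟩ a b ha hb hab
    refine ⟨a • y₁ + b • y₂, convex_convexHull ℝ _ hy₁ hy₂ ha hb hab, a • φ₁ + b • φ₂, fun s => ?_⟩
    have e1 : ∫ g, (a • φ₁ + b • φ₂ : C(K, ℝ)) g ∂η = a * ∫ g, φ₁ g ∂η + b * ∫ g, φ₂ g ∂η := by
      rw [← integral_const_mul, ← integral_const_mul, ← integral_add]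
      · rfl
      · exact (ContinuousMap.integrable_of_compactSpace η φ₁).const_mul a
      · exact (ContinuousMap.integrable_of_compactSpace η φ₂).const_mul b
    have e2 : F (a • y₁ + b • y₂ - c) s = a * F (y₁ - c) s + b * F (y₂ - c) s := by
      change s.2.1 (a • y₁ s.1 + b • y₂ s.1 - c s.1) =
        a * s.2.1 (y₁ s.1 - c s.1) + b * s.2.1 (y₂ s.1 - c s.1)
      simp only [map_sub, map_add, map_smul, smul_eq_mul]
      linear_combination (s.2.1 (c s.1)) * hab
    rw [e1, e2]
    change a * G₁ s + b * G₂ s = _ + (a * φ₁ s.1 + b * φ₂ s.1 - _)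
    rw [h₁, h₂]
    linear_combination (-(2 * (ε / 4))) * hab
  have hCs : ∀ G ∈ C, ∃ s, 0 ≤ G s := by
    rintro G₁ ⟨y, hy, φ, h⟩
    by_contra! hneg
    have yi := ContinuousMap.integrable_of_compactSpace η y
    have φi := ContinuousMap.integrable_of_compactSpace η φ
    have hle : ∀ g, ‖y g - c g‖ ≤ 2 * (ε / 4) - φ g + ∫ g, φ g ∂η := by
      intro g
      obtain ⟨l, hl⟩ := DualBall.exists_apply_eq_norm (y g - c g)
      have h1 := hneg (g, l)
      rw [h] at h1
      have h2 : F (y - c) (g, l) = ‖y g - c g‖ := hl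
      rw [h2] at h1
      dsimp only at h1
      linarith
    have := integral_mono (yi.sub ci).norm
      (((integrable_const (2 * (ε / 4))).sub φi).add (integrable_const (∫ g, φ g ∂η))) hle
    have e : ∫ g, (2 * (ε / 4) - φ g + ∫ g, φ g ∂η) ∂η = 2 * (ε / 4) := by
      have e1 : ∫ g, (2 * (ε / 4) - φ g + ∫ g, φ g ∂η) ∂η = _ :=
        integral_add ((integrable_const (2 * (ε / 4))).sub φi) (integrable_const (∫ g, φ g ∂η))
      have e2 : ∫ g, (2 * (ε / 4) - φ g) ∂η = _ := integral_sub (integrable_const _) φi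
      rw [e1, e2]
      simp
    have h3 := hyc y hy
    simp only [Pi.sub_apply, Pi.add_apply] at this
    linarith
  obtain ⟨μ, hμ, hμr, hμC⟩ := exists_probabilityMeasure_integral_nonneg hCc ⟨_, hG _ hvN 0⟩ hCs
  have hint : ∀ y φ, ∫ s, G y φ s ∂μ = ∫ s, F (y - c) s ∂μ - 2 * (ε / 4) +
      (∫ s, φ s.1 ∂μ - ∫ g, φ g ∂η) := by
    intro y φ
    have i1 := ContinuousMap.integrable_of_compactSpace μ (F (y - c))
    have i2 := ContinuousMap.integrable_of_compactSpace μ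
      (φ.comp ⟨Prod.fst, continuous_fst⟩ : C(S, ℝ))
    have e : ∫ s, G y φ s ∂μ = _ := integral_add (i1.sub (integrable_const (2 * (ε / 4))))
      (i2.sub (integrable_const (∫ g, φ g ∂η)))
    have e1 : ∫ s, (F (y - c) s - 2 * (ε / 4)) ∂μ = _ := integral_sub i1 (integrable_const _)
    have e2 : ∫ s : S, (φ s.1 - ∫ g, φ g ∂η) ∂μ = _ := integral_sub i2 (integrable_const _)
    refine e.trans ((congrArg₂ (· + ·) e1 e2).trans ?_)
    simp
  have hmarg : ∀ φ : C(K, ℝ), ∫ s : S, φ s.1 ∂μ = ∫ g, φ g ∂η := by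
    intro φ
    by_contra hne
    set A := ∫ s, F (v N - c) s ∂μ - 2 * (ε / 4)
    set B := ∫ s : S, φ s.1 ∂μ - ∫ g, φ g ∂η with hB
    have hB0 : B ≠ 0 := sub_ne_zero.2 hne
    have := hμC _ (hG _ hvN ((-(A + 1) / B) • φ))
    rw [hint] at this
    have e1 : ∫ s : S, ((-(A + 1) / B) • φ) s.1 ∂μ = (-(A + 1) / B) * ∫ s : S, φ s.1 ∂μ := by
      rw [← integral_const_mul]; rfl
    have e2 : ∫ g, ((-(A + 1) / B) • φ) g ∂η = (-(A + 1) / B) * ∫ g, φ g ∂η := by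
      rw [← integral_const_mul]; rfl
    rw [e1, e2, ← mul_sub, ← hB, div_mul_cancel₀ _ hB0] at this
    change 0 ≤ A + -(A + 1) at this
    linarith
  have hmap : μ.map Prod.fst ≤ η := map_le_of_integral_comp_eq continuous_fst hmarg
  have hfm : Measurable (Prod.fst : S → K) := continuous_fst.measurable
  have hvμ : ∀ᵐ s ∂μ, ∀ l : StrongDual ℝ X,
      Tendsto (fun n => l (v n s.1)) atTop (𝓝 (l (w s.1))) :=
    ae_of_ae_map hfm.aemeasurable (hmap.absolutelyContinuous.ae_le hv)
  have hlow : ∀ n ≥ N, 2 * (ε / 4) ≤ ∫ s, F (v n - c) s ∂μ := by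
    intro n hn
    have := hμC _ (hG (v n) (subset_convexHull _ _ ⟨n, hn, rfl⟩) 0)
    rw [hint, hmarg, sub_self, add_zero] at this
    linarith
  have hlim : Tendsto (fun n => ∫ s, F (v n - c) s ∂μ) atTop
      (𝓝 (∫ s, s.2.1 (w s.1 - c s.1) ∂μ)) := by
    refine tendsto_integral_of_dominated_convergence (fun _ => M + ‖c‖)
      (fun n => (ContinuousMap.integrable_of_compactSpace μ _).aestronglyMeasurable)
      (integrable_const _) (fun n => ae_of_all _ fun s => ?_) ?_
    · refine (s.2.abs_apply_le _).trans ((norm_sub_le _ _).trans ?_)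
      exact add_le_add (((v n).norm_coe_le_norm _).trans (hM n)) (c.norm_coe_le_norm _)
    · filter_upwards [hvμ] with s hs
      have h1 := (hs (WeakDual.toStrongDual s.2.1)).sub_const (s.2.1 (c s.1))
      have h2 : ∀ x : X, s.2.1 (x - c s.1) = WeakDual.toStrongDual s.2.1 x - s.2.1 (c s.1) :=
        fun x => map_sub _ _ _
      change Tendsto (fun n => s.2.1 (v n s.1 - c s.1)) atTop _
      simp only [h2]
      exact h1
  have h1 : 2 * (ε / 4) ≤ ∫ s, s.2.1 (w s.1 - c s.1) ∂μ :=
    ge_of_tendsto hlim (eventually_atTop.2 ⟨N, hlow⟩)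
  have wi : Integrable (fun g => ‖w g - c g‖) (μ.map Prod.fst) := (hw.sub ci).norm.mono_measure hmap
  have h2 : ‖∫ s, s.2.1 (w s.1 - c s.1) ∂μ‖ ≤ ∫ s, ‖w s.1 - c s.1‖ ∂μ :=
    norm_integral_le_of_norm_le (wi.comp_measurable hfm)
      (ae_of_all _ fun s => s.2.abs_apply_le _)
  have h3 : ∫ s, ‖w s.1 - c s.1‖ ∂μ = ∫ g, ‖w g - c g‖ ∂(μ.map Prod.fst) :=
    (integral_map hfm.aemeasurable wi.aestronglyMeasurable).symm
  have h4 : ∫ g, ‖w g - c g‖ ∂(μ.map Prod.fst) ≤ ∫ g, ‖w g - c g‖ ∂η :=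
    integral_mono_measure hmap (ae_of_all _ fun _ => norm_nonneg _) (hw.sub ci).norm
  have h5 := le_abs_self (∫ s, s.2.1 (w s.1 - c s.1) ∂μ)
  rw [Real.norm_eq_abs] at h2
  linarith

/-- A separable subspace has a sequence of functionals of norm at most one separating its points. -/
theorem exists_seq_dual_separating {X : Type*} [NormedAddCommGroup X] [NormedSpace ℝ X]
    (X₀ : Submodule ℝ X) [TopologicalSpace.SeparableSpace X₀] :
    ∃ D : ℕ → StrongDual ℝ X, (∀ j, ‖D j‖ ≤ 1) ∧ ∀ x ∈ X₀, (∀ j, D j x = 0) → x = 0 := by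
  choose D hD hDx using fun j => exists_dual_vector'' ℝ (TopologicalSpace.denseSeq X₀ j : X)
  refine ⟨D, hD, fun x hx h0 => ?_⟩
  by_contra hne
  have hpos : 0 < ‖x‖ := norm_pos_iff.2 hne
  obtain ⟨j, hj⟩ := (TopologicalSpace.denseRange_denseSeq X₀).exists_dist_lt
    (⟨x, hx⟩ : X₀) (half_pos hpos)
  set z : X := (TopologicalSpace.denseSeq X₀ j : X)
  have h1 : ‖x - z‖ < ‖x‖ / 2 := by
    rw [← dist_eq_norm]; exact hj
  have h2 : ‖z‖ ≤ ‖x - z‖ := by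
    have e : D j (z - x) = ‖z‖ := by rw [map_sub, h0, sub_zero]; exact hDx j
    rw [← e, norm_sub_rev x z]
    exact (le_abs_self _).trans (((D j).le_of_opNorm_le (hD j) _).trans (one_mul _).le)
  have h3 := norm_sub_norm_le x z
  linarith

/-- Bounded sequences of continuous functions with values in a reflexive space have forward convex
blocks converging weakly almost everywhere to a strongly measurable function. -/
theorem exists_convexHull_tendsto_dual_ae {K X : Type*} [TopologicalSpace K] [CompactSpace K]
    [MeasurableSpace K] [BorelSpace K] [NormedAddCommGroup X] [NormedSpace ℝ X]
    [CompleteSpace X] (hX : IsReflexive X) (η : Measure K) [IsFiniteMeasure η]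
    {u : ℕ → C(K, X)} {M : ℝ} (hM : ∀ n, ‖u n‖ ≤ M) :
    ∃ (v : ℕ → C(K, X)) (w : K → X), (∀ n, v n ∈ convexHull ℝ (u '' Set.Ici n)) ∧
      AEStronglyMeasurable w η ∧
      ∀ᵐ g ∂η, ∀ l : StrongDual ℝ X, Tendsto (fun n => l (v n g)) atTop (𝓝 (l (w g))) := by
  let X₀ : Submodule ℝ X := (Submodule.span ℝ (⋃ n, Set.range (u n))).topologicalClosure
  have hX₀c : IsClosed (X₀ : Set X) := Submodule.isClosed_topologicalClosure _
  have hsep : TopologicalSpace.IsSeparable (X₀ : Set X) :=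
    (TopologicalSpace.IsSeparable.span (R := ℝ) (TopologicalSpace.IsSeparable.iUnion fun n =>
      (isCompact_range (u n).continuous).isSeparable)).closure
  have hss : TopologicalSpace.SeparableSpace X₀ := hsep.separableSpace
  have hcs : CompleteSpace X₀ := hX₀c.completeSpace_coe
  have : SecondCountableTopology X₀ := UniformSpace.secondCountable_of_separable X₀
  have hu : ∀ n g, u n g ∈ X₀ := fun n g =>
    Submodule.le_topologicalClosure _ (Submodule.subset_span (Set.mem_iUnion.2 ⟨n, g, rfl⟩))
  obtain ⟨D, hD1, hD⟩ := exists_seq_dual_separating X₀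
  let ν : Measure ℕ := (Measure.count : Measure ℕ).toFinite
  have hν : ∀ p : ℕ → Prop, (∀ᵐ j ∂ν, p j) → ∀ j, p j := by
    intro p hp j
    have h1 : ∀ᵐ j ∂(Measure.count : Measure ℕ), p j := by
      rwa [← ae_toFinite]
    by_contra hj
    have h2 := measure_mono_null (Set.singleton_subset_iff.2 hj) (ae_iff.1 h1)
    simp at h2
  have mem : ∀ y : C(K, X), MeasureTheory.MemLp (fun z : K × ℕ => D z.2 (y z.1)) 2 (η.prod ν) := by
    intro y
    refine MeasureTheory.MemLp.of_bound (Measurable.aestronglyMeasurable ?_) ‖y‖ (ae_of_all _ fun z => ?_)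
    · exact measurable_from_prod_countable_left fun j => ((D j).continuous.comp y.continuous).measurable
    · exact ((D z.2).le_of_opNorm_le (hD1 _) _).trans ((one_mul _).le.trans (y.norm_coe_le_norm _))
  let Φ : C(K, X) →ₗ[ℝ] MeasureTheory.Lp ℝ 2 (η.prod ν) :=
    { toFun := fun y => (mem y).toLp _
      map_add' := fun y z => by
        rw [← MeasureTheory.MemLp.toLp_add]
        exact MeasureTheory.MemLp.toLp_congr _ _ (ae_of_all _ fun s => map_add _ _ _)
      map_smul' := fun r y => by
        rw [RingHom.id_apply, ← MeasureTheory.MemLp.toLp_const_smul]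
        exact MeasureTheory.MemLp.toLp_congr _ _ (ae_of_all _ fun s => map_smul _ _ _) }
  have hΦ : ∃ M', ∀ n, ‖Φ (u n)‖ ≤ M' := by
    refine ⟨(measureUnivNNReal (η.prod ν) : ℝ) ^ ((2 : ℝ≥0∞).toReal)⁻¹ * M, fun n => ?_⟩
    refine MeasureTheory.Lp.norm_le_of_ae_bound ((norm_nonneg _).trans (hM n)) ?_
    filter_upwards [(mem (u n)).coeFn_toLp] with z hz
    change ‖(mem (u n)).toLp _ z‖ ≤ M
    rw [hz]
    exact ((D z.2).le_of_opNorm_le (hD1 _) _).trans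
      ((one_mul _).le.trans (((u n).norm_coe_le_norm _).trans (hM n)))
  obtain ⟨M', hM'⟩ := hΦ
  obtain ⟨z, hz, hzc⟩ := exists_cauchySeq_convexHull_of_inner (fun n => Φ (u n)) hM'
  have hz' : ∀ n, ∃ y ∈ convexHull ℝ (u '' Set.Ici n), Φ y = z n := by
    intro n
    have := hz n
    rw [← Set.image_image Φ u, ← LinearMap.image_convexHull] at this
    exact this
  choose y hy hyz using hz'
  obtain ⟨z₀, hz₀⟩ := cauchySeq_tendsto_of_complete hzc
  obtain ⟨k, hk, hae⟩ := (tendstoInMeasure_of_tendsto_Lp hz₀).exists_seq_tendsto_ae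
  let v : ℕ → C(K, X) := fun n => y (k n)
  have hv : ∀ n, v n ∈ convexHull ℝ (u '' Set.Ici n) := fun n =>
    convexHull_mono (Set.image_mono (Set.Ici_subset_Ici.2 hk.le_apply)) (hy (k n))
  have hvM : ∀ n, ‖v n‖ ≤ M := by
    intro n
    refine mem_closedBall_zero_iff.1
      (convexHull_min ?_ (convex_closedBall (0 : C(K, X)) M) (hv n))
    rintro _ ⟨j, -, rfl⟩
    exact mem_closedBall_zero_iff.2 (hM j)
  have hvX : ∀ n g, v n g ∈ X₀ := by
    intro n g
    let V : Submodule ℝ C(K, X) :=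
      { carrier := {y | y g ∈ X₀}
        zero_mem' := X₀.zero_mem
        add_mem' := fun ha hb => X₀.add_mem ha hb
        smul_mem' := fun c _ ha => X₀.smul_mem c ha }
    refine (convexHull_min ?_ V.convex (hv n) : v n ∈ V)
    rintro _ ⟨j, -, rfl⟩
    exact hu j g
  have hconv : ∀ᵐ g ∂η, ∀ j, ∃ r, Tendsto (fun n => D j (v n g)) atTop (𝓝 r) := by
    have h1 : ∀ᵐ s ∂(η.prod ν), ∃ r, Tendsto (fun n => D s.2 (v n s.1)) atTop (𝓝 r) := by
      have h2 : ∀ᵐ s ∂(η.prod ν), ∀ n, z (k n) s = D s.2 (v n s.1) := by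
        refine ae_all_iff.2 fun n => ?_
        filter_upwards [(mem (v n)).coeFn_toLp] with s hs
        rw [← hs, ← hyz]
        rfl
      filter_upwards [hae, h2] with s hs hs'
      simp only [hs'] at hs
      exact ⟨_, hs⟩
    filter_upwards [Measure.ae_ae_of_ae_prod h1] with g hg
    exact hν _ hg
  have hw : ∀ g, ∃ w : X₀, (∀ j, ∃ r, Tendsto (fun n => D j (v n g)) atTop (𝓝 r)) →
      ∀ l : StrongDual ℝ X, Tendsto (fun n => l (v n g)) atTop (𝓝 (l w)) := by
    intro g
    by_cases hg : ∀ j, ∃ r, Tendsto (fun n => D j (v n g)) atTop (𝓝 r)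
    · obtain ⟨w, hw, hwl⟩ := exists_tendsto_dual_of_separating hX hX₀c hD (fun n => hvX n g)
        (fun n => ((v n).norm_coe_le_norm g).trans (hvM n)) hg
      exact ⟨⟨w, hw⟩, fun _ => hwl⟩
    · exact ⟨0, fun h => absurd h hg⟩
  choose w hw using hw
  have hlim : ∀ᵐ g ∂η, ∀ l : StrongDual ℝ X,
      Tendsto (fun n => l (v n g)) atTop (𝓝 (l (w g))) := hconv.mono hw
  refine ⟨v, fun g => w g, hv, ?_, hlim⟩
  let : MeasurableSpace X₀ := borel X₀
  have : BorelSpace X₀ := ⟨rfl⟩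
  let J : X₀ → ℕ → ℝ := fun x j => D j x
  have hJc : Continuous J := continuous_pi fun j => (D j).continuous.comp continuous_subtype_val
  have hJi : Function.Injective J := fun a b hab => Subtype.ext (sub_eq_zero.1
    (hD _ (X₀.sub_mem a.2 b.2) fun j => by rw [map_sub]; exact sub_eq_zero.2 (congrFun hab j)))
  have hJ : MeasurableEmbedding J := hJc.measurableEmbedding hJi
  have hJw : AEMeasurable (J ∘ w) η := by
    refine aemeasurable_of_tendsto_metrizable_ae atTop (f := fun n g j => D j (v n g))
      (fun n => (measurable_pi_lambda _ fun j =>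
        ((D j).continuous.comp (v n).continuous).measurable).aemeasurable) ?_
    filter_upwards [hlim] with g hg
    exact tendsto_pi_nhds.2 fun j => hg (D j)
  exact continuous_subtype_val.comp_aestronglyMeasurable
    (hJ.aemeasurable_comp_iff.1 hJw).aestronglyMeasurable

/-- Bounded sequences of continuous functions with values in a reflexive space have forward convex
blocks converging in `L^1(η; X)`. -/
theorem exists_convexHull_tendsto_integral_norm_sub {K X : Type*} [TopologicalSpace K]
    [CompactSpace K] [T2Space K] [MeasurableSpace K] [BorelSpace K] [NormedAddCommGroup X]
    [NormedSpace ℝ X] [CompleteSpace X] (hX : IsReflexive X) (η : Measure K)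
    [IsProbabilityMeasure η] [η.Regular] {u : ℕ → C(K, X)} {M : ℝ} (hM : ∀ n, ‖u n‖ ≤ M) :
    ∃ (y : ℕ → C(K, X)) (w : K → X), (∀ n, y n ∈ convexHull ℝ (u '' Set.Ici n)) ∧
      Integrable w η ∧ Tendsto (fun n => ∫ g, ‖y n g - w g‖ ∂η) atTop (𝓝 0) := by
  obtain ⟨v, w, hv, hwm, hvw⟩ := exists_convexHull_tendsto_dual_ae hX η hM
  have hvM : ∀ n, ‖v n‖ ≤ M := by
    intro n
    refine mem_closedBall_zero_iff.1
      (convexHull_min ?_ (convex_closedBall (0 : C(K, X)) M) (hv n))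
    rintro _ ⟨j, -, rfl⟩
    exact mem_closedBall_zero_iff.2 (hM j)
  have hM0 : 0 ≤ M := (norm_nonneg _).trans (hM 0)
  have hwi : Integrable w η := by
    refine Integrable.of_bound hwm M (hvw.mono fun g hg => ?_)
    refine NormedSpace.norm_le_dual_bound ℝ _ hM0 fun l => ?_
    refine le_of_tendsto (hg l).norm (Eventually.of_forall fun n => ?_)
    rw [mul_comm]
    exact (l.le_opNorm _).trans (mul_le_mul_of_nonneg_left
      (((v n).norm_coe_le_norm g).trans (hvM n)) (norm_nonneg _))
  choose y hy hyw using fun n : ℕ => exists_convexHull_integral_norm_sub_lt hvM hwi hvw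
    (ε := 1 / ((n : ℝ) + 1)) (by positivity) n
  refine ⟨y, w, fun n => convexHull_min ?_ (convex_convexHull ℝ _) (hy n), hwi, ?_⟩
  · rintro _ ⟨j, hj, rfl⟩
    exact convexHull_mono (Set.image_mono (Set.Ici_subset_Ici.2 hj)) (hv j)
  · exact squeeze_zero (fun n => integral_nonneg fun _ => norm_nonneg _) (fun n => (hyw n).le)
      tendsto_one_div_add_atTop_nhds_zero_nat

lemma tendsto_norm_zero_of_rpow {E : Type*} [NormedAddCommGroup E] {q : ℝ} {x : ℕ → E} (hq : 0 < q)
    (h : Tendsto (fun n => ‖x n‖ ^ q) atTop (𝓝 0)) : Tendsto (fun n => ‖x n‖) atTop (𝓝 0) := by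
  have h1 : Tendsto (fun n => (‖x n‖ ^ q) ^ (1 / q)) atTop (𝓝 (0 ^ (1 / q))) :=
    h.rpow_const (Or.inr (by positivity))
  rw [Real.zero_rpow (by positivity)] at h1
  refine h1.congr fun n => ?_
  rw [← Real.rpow_mul (norm_nonneg _), mul_one_div_cancel hq.ne', Real.rpow_one]

lemma norm_rpow_inv_smul_rpow {V : Type*} [NormedAddCommGroup V] [NormedSpace ℝ V] {q : ℝ}
    (hq : 0 < q) {a : ℝ} (ha : 0 ≤ a) (x : V) : ‖a ^ (1 / q) • x‖ ^ q = a * ‖x‖ ^ q := by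
  have h0 : 0 ≤ a ^ (1 / q) := Real.rpow_nonneg ha _
  rw [norm_smul, Real.norm_of_nonneg h0, Real.mul_rpow h0 (norm_nonneg _), ← Real.rpow_mul ha,
    one_div_mul_cancel hq.ne', Real.rpow_one]

section Domination

variable {K X F E : Type*} [TopologicalSpace K] [CompactSpace K] [MeasurableSpace K]
  [BorelSpace K] [NormedAddCommGroup X] [NormedSpace ℝ X] [NormedAddCommGroup F] [NormedSpace ℝ F]
  [NormedAddCommGroup E] [NormedSpace ℝ E]

/-- The Pietsch domination theorem. -/
theorem exists_measure_norm_rpow_le_integral [T2Space K] (U : F →ₗ[ℝ] C(K, X)) (T : F →ₗ[ℝ] E) {q : ℝ}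
    (hq : 0 < q) {B : ℝ}
    (h : ∀ (n : ℕ) (f : Fin n → F), ∃ k, ∑ i, ‖T (f i)‖ ^ q ≤ B * ∑ i, ‖U (f i) k‖ ^ q) :
    ∃ μ : Measure K, IsProbabilityMeasure μ ∧ μ.Regular ∧
      ∀ f, ‖T f‖ ^ q ≤ B * ∫ k, ‖U f k‖ ^ q ∂μ := by
  let ψ : F → C(K, ℝ) := fun f =>
    ⟨fun k => B * ‖U f k‖ ^ q - ‖T f‖ ^ q, (((U f).continuous.norm.rpow_const
      fun _ => Or.inr hq.le).const_mul B).sub continuous_const⟩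
  have hψ : ∀ a : ℝ, 0 ≤ a → ∀ f, ψ (a ^ (1 / q) • f) = a • ψ f := by
    intro a ha f
    ext k
    change B * ‖U (a ^ (1 / q) • f) k‖ ^ q - ‖T (a ^ (1 / q) • f)‖ ^ q =
      a * (B * ‖U f k‖ ^ q - ‖T f‖ ^ q)
    rw [map_smul, map_smul, ContinuousMap.smul_apply, norm_rpow_inv_smul_rpow hq ha,
      norm_rpow_inv_smul_rpow hq ha]
    ring
  let C : Set C(K, ℝ) := {G | ∃ (n : ℕ) (f : Fin n → F), G = ∑ i, ψ (f i)}
  have hC : Convex ℝ C := by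
    rintro _ ⟨n, f, rfl⟩ _ ⟨n', f', rfl⟩ a b ha hb -
    refine ⟨n + n', Fin.append (fun i => a ^ (1 / q) • f i) (fun i => b ^ (1 / q) • f' i), ?_⟩
    simp only [Fin.sum_univ_add, Fin.append_left, Fin.append_right, hψ a ha, hψ b hb,
      Finset.smul_sum]
  obtain ⟨μ, hμ, hμr, hμC⟩ := exists_probabilityMeasure_integral_nonneg hC
    ⟨0, 0, Fin.elim0, by simp⟩ (by
      rintro _ ⟨n, f, rfl⟩
      obtain ⟨k, hk⟩ := h n f
      refine ⟨k, ?_⟩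
      rw [ContinuousMap.sum_apply]
      change 0 ≤ ∑ i, (B * ‖U (f i) k‖ ^ q - ‖T (f i)‖ ^ q)
      rw [Finset.sum_sub_distrib, ← Finset.mul_sum]
      linarith)
  refine ⟨μ, hμ, hμr, fun f => ?_⟩
  have h1 := hμC (ψ f) ⟨1, fun _ => f, by simp⟩
  have hi := ContinuousMap.integrable_of_compactSpace μ
    (⟨fun k => ‖U f k‖ ^ q, (U f).continuous.norm.rpow_const fun _ => Or.inr hq.le⟩ : C(K, ℝ))
  have h2 : ∫ k, ψ f k ∂μ = _ := integral_sub (hi.const_mul B) (integrable_const (‖T f‖ ^ q))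
  rw [h2, integral_const_mul] at h1
  simp only [integral_const, probReal_univ, one_smul] at h1
  linarith

variable {U : F →ₗ[ℝ] C(K, X)} {q B : ℝ} {μ : Measure K} [IsProbabilityMeasure μ]

/-- A dominated operator maps bounded pointwise null sequences to null sequences. -/
theorem tendsto_norm_of_dominated {T : F →ₗ[ℝ] E} (hq : 0 < q)
    (hT : ∀ f, ‖T f‖ ^ q ≤ B * ∫ k, ‖U f k‖ ^ q ∂μ) {f : ℕ → F} {M : ℝ}
    (hM : ∀ n, ‖U (f n)‖ ≤ M) (hf : ∀ k, Tendsto (fun n => ‖U (f n) k‖) atTop (𝓝 0)) :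
    Tendsto (fun n => ‖T (f n)‖) atTop (𝓝 0) := by
  refine tendsto_norm_zero_of_rpow hq ?_
  have h1 : Tendsto (fun n => ∫ k, ‖U (f n) k‖ ^ q ∂μ) atTop (𝓝 (∫ _, (0 : ℝ) ∂μ)) := by
    refine tendsto_integral_of_dominated_convergence (fun _ => M ^ q)
      (fun n => ((U (f n)).continuous.norm.rpow_const
        fun _ => Or.inr hq.le).aestronglyMeasurable) (integrable_const _)
      (fun n => ae_of_all _ fun k => ?_) (ae_of_all _ fun k => ?_)
    · rw [Real.norm_of_nonneg (by positivity)]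
      exact Real.rpow_le_rpow (norm_nonneg _) (((U (f n)).norm_coe_le_norm k).trans (hM n)) hq.le
    · have := (hf k).rpow_const (p := q) (Or.inr hq.le)
      rwa [Real.zero_rpow hq.ne'] at this
  rw [integral_zero] at h1
  have h2 := h1.const_mul B
  rw [mul_zero] at h2
  exact squeeze_zero (fun n => by positivity) (fun n => hT (f n)) h2

/-- A dominated operator is weakly compact if the functions take values in a reflexive space. -/
theorem isWeaklyCompact_of_dominated [T2Space K] [CompleteSpace X] [CompleteSpace E] [μ.Regular]
    (hX : IsReflexive X) {T : F →L[ℝ] E}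
    (hq : 1 ≤ q) (hB : 0 ≤ B) (hT : ∀ f, ‖T f‖ ^ q ≤ B * ∫ k, ‖U f k‖ ^ q ∂μ) {M : ℝ}
    (hM : ∀ f, ‖f‖ ≤ 1 → ‖U f‖ ≤ M) : IsWeaklyCompact T := by
  have hq0 : 0 < q := one_pos.trans_le hq
  have hM0 : 0 ≤ M := (norm_nonneg _).trans (hM 0 (by simp))
  refine isCompact_closure_toWeakSpace_image
    (T.lipschitz.isBounded_image Metric.isBounded_closedBall) fun a ha => ?_
  choose f hf hfa using ha
  have hf1 : ∀ n, ‖f n‖ ≤ 1 := fun n => mem_closedBall_zero_iff.1 (hf n)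
  obtain ⟨y, w, hy, hwi, hyw⟩ := exists_convexHull_tendsto_integral_norm_sub hX μ
    (u := fun n => U (f n)) fun n => hM _ (hf1 n)
  have hz : ∀ n, ∃ z ∈ convexHull ℝ (f '' Set.Ici n), U z = y n := by
    intro n
    have := hy n
    rw [← Set.image_image U f, ← LinearMap.image_convexHull] at this
    exact this
  choose z hz hzy using hz
  have hz1 : ∀ n, ‖z n‖ ≤ 1 := by
    intro n
    refine mem_closedBall_zero_iff.1
      (convexHull_min ?_ (convex_closedBall (0 : F) 1) (hz n))
    rintro _ ⟨j, -, rfl⟩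
    exact hf j
  refine ⟨fun n => T (z n), fun n => ?_, ?_⟩
  · have h1 : (T : F →ₗ[ℝ] E) (z n) ∈ (T : F →ₗ[ℝ] E) '' convexHull ℝ (f '' Set.Ici n) :=
      ⟨_, hz n, rfl⟩
    rw [LinearMap.image_convexHull, Set.image_image] at h1
    simpa only [ContinuousLinearMap.coe_coe, hfa] using h1
  · have key : ∀ n k, ‖T (z n) - T (z k)‖ ^ q ≤ B * (2 * M) ^ (q - 1) *
        (∫ g, ‖y n g - w g‖ ∂μ + ∫ g, ‖y k g - w g‖ ∂μ) := by
      intro n k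
      have i1 := ((ContinuousMap.integrable_of_compactSpace μ (y n)).sub hwi).norm
      have i2 := ((ContinuousMap.integrable_of_compactSpace μ (y k)).sub hwi).norm
      have e : ∫ g, (‖y n g - w g‖ + ‖y k g - w g‖) ∂μ = _ := integral_add i1 i2
      rw [← map_sub, mul_assoc]
      refine (hT _).trans (mul_le_mul_of_nonneg_left ?_ hB)
      refine le_trans ?_ (mul_le_mul_of_nonneg_left e.le (by positivity))
      rw [← integral_const_mul]
      refine integral_mono (ContinuousMap.integrable_of_compactSpace μ
        (⟨fun g => ‖U (z n - z k) g‖ ^ q, (U (z n - z k)).continuous.norm.rpow_const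
          fun _ => Or.inr hq0.le⟩ : C(K, ℝ))) ((i1.add i2).const_mul _) fun g => ?_
      dsimp only
      rw [map_sub, hzy, hzy, ContinuousMap.sub_apply]
      have hyM : ∀ n, ‖y n g‖ ≤ M := fun n => by
        rw [← hzy]
        exact ((U (z n)).norm_coe_le_norm g).trans (hM _ (hz1 n))
      have b1 : ‖y n g - y k g‖ ≤ 2 * M := by
        linarith [norm_sub_le (y n g) (y k g), hyM n, hyM k]
      have b2 : ‖y n g - y k g‖ ≤ ‖y n g - w g‖ + ‖y k g - w g‖ := by
        have := norm_sub_le (y n g - w g) (y k g - w g)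
        rwa [sub_sub_sub_cancel_right] at this
      rcases (norm_nonneg (y n g - y k g)).eq_or_lt with h0 | h0
      · rw [← h0, Real.zero_rpow hq0.ne']
        positivity
      · calc ‖y n g - y k g‖ ^ q = ‖y n g - y k g‖ ^ (q - 1) * ‖y n g - y k g‖ := by
              rw [← Real.rpow_add_one h0.ne', sub_add_cancel]
          _ ≤ _ := mul_le_mul (Real.rpow_le_rpow h0.le b1 (by linarith)) b2 h0.le (by positivity)
    refine Metric.cauchySeq_iff'.2 fun ε hε => ?_
    have hεq : 0 < ε ^ q := Real.rpow_pos_of_pos hε q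
    have hsmall : Tendsto (fun n => B * (2 * M) ^ (q - 1) * ∫ g, ‖y n g - w g‖ ∂μ) atTop (𝓝 0) := by
      simpa using hyw.const_mul (B * (2 * M) ^ (q - 1))
    obtain ⟨N, hN⟩ := eventually_atTop.1 (hsmall.eventually_lt_const (half_pos hεq))
    refine ⟨N, fun n hn => ?_⟩
    rw [dist_eq_norm]
    refine lt_of_not_ge fun hge => ?_
    have h1 := Real.rpow_le_rpow hε.le hge hq0.le
    have h2 := key n N
    have h3 := hN n hn
    have h4 := hN N le_rfl
    rw [mul_add] at h2
    linarith

end Domination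

lemma aeEqFun_add_mul {α : Type*} [MeasurableSpace α] {μ : Measure α} (f f' g : α →ₘ[μ] ℝ) :
    (f + f') * g = f * g + f' * g := by
  refine AEEqFun.ext ?_
  filter_upwards [AEEqFun.coeFn_mul (f + f') g, AEEqFun.coeFn_add f f', AEEqFun.coeFn_mul f g,
    AEEqFun.coeFn_mul f' g, AEEqFun.coeFn_add (f * g) (f' * g)] with ω h1 h2 h3 h4 h5
  rw [h1, h5, Pi.mul_apply, h2, Pi.add_apply, Pi.add_apply, h3, h4]
  exact add_mul _ _ _

lemma aeEqFun_smul_mul {α : Type*} [MeasurableSpace α] {μ : Measure α} (c : ℝ) (f g : α →ₘ[μ] ℝ) :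
    (c • f) * g = c • (f * g) := by
  refine AEEqFun.ext ?_
  filter_upwards [AEEqFun.coeFn_mul (c • f) g, AEEqFun.coeFn_smul c f, AEEqFun.coeFn_mul f g,
    AEEqFun.coeFn_smul c (f * g)] with ω h1 h2 h3 h4
  rw [h1, h4, Pi.mul_apply, h2, Pi.smul_apply, Pi.smul_apply, h3]
  exact smul_mul_assoc c _ _

section Pairing

variable {Ω X : Type*} [MeasurableSpace Ω] [NormedAddCommGroup X] [NormedSpace ℝ X]
  [CompleteSpace X] {m : VectorMeasure Ω X} {p p' : ℝ≥0∞} [hp : Fact (1 ≤ p)]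
  [hp' : Fact (1 ≤ p')] [p.HolderConjugate p']

lemma Lp.integral_add (f g : Lp m 1) : Lp.integral (f + g) = Lp.integral f + Lp.integral g := by
  refine SeparatingDual.eq_iff_forall_dual_eq (R := ℝ) |>.2 fun l => ?_
  rw [map_add, Lp.integral_spec, Lp.integral_spec, Lp.integral_spec,
    ← VectorMeasure.integral_fun_add ((Lp.isIntegrable f).integrable_scalar l)
      ((Lp.isIntegrable g).integrable_scalar l)]
  exact VectorMeasure.integral_congr_ae ((scalar_variation_ac m l).ae_eq (AEEqFun.coeFn_add _ _))

lemma Lp.integral_smul (c : ℝ) (f : Lp m 1) : Lp.integral (c • f) = c • Lp.integral f := by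
  refine SeparatingDual.eq_iff_forall_dual_eq (R := ℝ) |>.2 fun l => ?_
  rw [map_smul, Lp.integral_spec, Lp.integral_spec, ← VectorMeasure.integral_fun_smul]
  exact VectorMeasure.integral_congr_ae ((scalar_variation_ac m l).ae_eq (AEEqFun.coeFn_smul _ _))

lemma pairing_add_left (f f' : Lp m p) (g : Lp m p') :
    pairing (f + f') g = pairing f g + pairing f' g := by
  have h : Lp.mul (f + f') g = Lp.mul f g + Lp.mul f' g :=
    Subtype.ext (aeEqFun_add_mul (f : Ω →ₘ[m.variation] ℝ) f' g)
  rw [pairing, pairing, pairing, ← Lp.integral_add, h]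

lemma pairing_smul_left (c : ℝ) (f : Lp m p) (g : Lp m p') :
    pairing (c • f) g = c • pairing f g := by
  have h : Lp.mul (c • f) g = c • Lp.mul f g :=
    Subtype.ext (aeEqFun_smul_mul c (f : Ω →ₘ[m.variation] ℝ) g)
  rw [pairing, pairing, ← Lp.integral_smul, h]

lemma pairing_comm (f : Lp m p) (g : Lp m p') : pairing f g = pairing g f := by
  have h : Lp.mul f g = Lp.mul g f :=
    Subtype.ext (mul_comm (f : Ω →ₘ[m.variation] ℝ) (g : Ω →ₘ[m.variation] ℝ))
  rw [pairing, pairing, h]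

lemma pairing_smul_right (c : ℝ) (f : Lp m p) (g : Lp m p') :
    pairing f (c • g) = c • pairing f g := by
  rw [pairing_comm, pairing_smul_left, pairing_comm]

lemma IsNorming.exists_norm_pairing_le {P : Submodule ℝ (Lp m p)} {R : Submodule ℝ (Lp m p')}
    (h : IsNorming P R) : ∃ C : ℝ, 0 ≤ C ∧
      ∀ (f : P) (g : R), ‖pairing (f : Lp m p) (g : Lp m p')‖ ≤ C * ‖f‖ * ‖g‖ := by
  obtain ⟨_, C, _, h⟩ := h
  have hb : ∀ (f : P) (g : R), ‖g‖ ≤ 1 → ‖pairing (f : Lp m p) (g : Lp m p')‖ ≤ C * ‖f‖ := by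
    intro f g hg
    have h1 := (le_iSup₂ (f := fun (g : R) (_ : g ∈ Metric.closedBall (0 : R) 1) =>
      ‖pairing (f : Lp m p) (g : Lp m p')‖ₑ) g (mem_closedBall_zero_iff.2 hg)).trans (h f).2
    rw [← ofReal_norm, ← ofReal_norm, ← ENNReal.ofReal_coe_nnreal,
      ← ENNReal.ofReal_mul C.coe_nonneg] at h1
    exact (ENNReal.ofReal_le_ofReal_iff (by positivity)).1 h1
  refine ⟨C, C.coe_nonneg, fun f g => ?_⟩
  rcases eq_or_ne g 0 with rfl | hg
  · have : pairing (f : Lp m p) ((0 : R) : Lp m p') = 0 := by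
      have := pairing_smul_right 0 (f : Lp m p) (0 : Lp m p')
      rwa [zero_smul, zero_smul] at this
    rw [this]
    simp
  · have hn : 0 < ‖g‖ := norm_pos_iff.2 hg
    have h1 := hb f (‖g‖⁻¹ • g) (by rw [norm_smul, norm_inv, norm_norm, inv_mul_cancel₀ hn.ne'])
    rw [Submodule.coe_smul, pairing_smul_right, norm_smul, norm_inv, norm_norm,
      inv_mul_le_iff₀ hn] at h1
    linarith

lemma IsNorming.eq_zero {P : Submodule ℝ (Lp m p)} {R : Submodule ℝ (Lp m p')}
    (h : IsNorming P R) (f : P) (hf : ∀ g : R, pairing (f : Lp m p) (g : Lp m p') = 0) :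
    f = 0 := by
  obtain ⟨c, _, hc, h⟩ := h
  have h1 := (h f).1
  have h2 : normingFun R (f : Lp m p) = 0 := by
    simp [normingFun, hf]
  rw [h2, nonpos_iff_eq_zero, mul_eq_zero] at h1
  have h3 : ‖f‖ₑ = 0 := h1.resolve_left (by simpa using hc.ne')
  rw [← ofReal_norm, ENNReal.ofReal_eq_zero] at h3
  exact norm_le_zero_iff.1 h3

/-- The closed unit ball of `R`, with the topology `τ_m(Q)`. -/
def TauBall (R : Submodule ℝ (Lp m p)) (_ : Submodule ℝ (Lp m p')) : Type _ :=
  ↥(Metric.closedBall (0 : R) 1)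

variable {R : Submodule ℝ (Lp m p)} {Q : Submodule ℝ (Lp m p')}

noncomputable instance : TopologicalSpace (TauBall R Q) :=
  (tauTopology R Q).induced Subtype.val

lemma continuous_tauTopology (h : Q) :
    Continuous[tauTopology R Q, _] fun f : R => pairing (f : Lp m p) (h : Lp m p') :=
  continuous_iInf_dom (i := h) continuous_induced_dom

lemma TauBall.continuous_pairing (h : Q) :
    Continuous fun g : TauBall R Q => pairing (g.1 : Lp m p) (h : Lp m p') :=
  @Continuous.comp _ _ _ _ (tauTopology R Q) _ _ _ (continuous_tauTopology h) continuous_induced_dom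

lemma TauBall.compactSpace (h : IsTauCompactBall R Q) : CompactSpace (TauBall R Q) :=
  (@isCompact_iff_compactSpace R (tauTopology R Q) _).1 h

lemma TauBall.t2Space (h : IsNorming R Q) : T2Space (TauBall R Q) := by
  refine T2Space.of_injective_continuous
    (f := fun (g : TauBall R Q) (k : Q) => pairing (g.1 : Lp m p) (k : Lp m p'))
    (fun a b hab => ?_) (continuous_pi fun k => TauBall.continuous_pairing k)
  refine Subtype.ext (sub_eq_zero.1 (h.eq_zero _ fun k => ?_))
  have h1 : pairing (a.1 : Lp m p) (k : Lp m p') = pairing (b.1 : Lp m p) (k : Lp m p') :=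
    congrFun hab k
  have h2 := pairing_smul_left (-1) (b.1 : Lp m p) (k : Lp m p')
  rw [Submodule.coe_sub, sub_eq_add_neg, ← neg_one_smul ℝ (b.1 : Lp m p), pairing_add_left, h2, h1]
  simp

lemma TauBall.continuous_pairing_right (f : Q) :
    Continuous fun g : TauBall R Q => pairing (f : Lp m p') (g.1 : Lp m p) := by
  have h := TauBall.continuous_pairing (R := R) f
  convert h using 2
  exact pairing_comm _ _

/-- Integration against the elements of the unit ball of `R`, as a linear map into the continuous
functions on this ball. -/
noncomputable def TauBall.toContinuousMap {P : Submodule ℝ (Lp m p')} (hP : P ≤ Q) :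
    P →ₗ[ℝ] C(TauBall R Q, X) where
  toFun f := ⟨fun g => pairing (f : Lp m p') (g.1 : Lp m p),
    TauBall.continuous_pairing_right (Submodule.inclusion hP f)⟩
  map_add' f f' := ContinuousMap.ext fun g =>
    pairing_add_left (f : Lp m p') (f' : Lp m p') (g.1 : Lp m p)
  map_smul' c f := ContinuousMap.ext fun g => pairing_smul_left c (f : Lp m p') (g.1 : Lp m p)

lemma TauBall.toContinuousMap_apply {P : Submodule ℝ (Lp m p')} (hP : P ≤ Q) (f : P)
    (g : TauBall R Q) :
    TauBall.toContinuousMap hP f g = pairing (f : Lp m p') (g.1 : Lp m p) := rfl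

end Pairing

section Summing

variable {Ω X E : Type*} [MeasurableSpace Ω] [NormedAddCommGroup X] [NormedSpace ℝ X]
  [CompleteSpace X] [NormedAddCommGroup E] [NormedSpace ℝ E] {m : VectorMeasure Ω X}
  {p p' : ℝ≥0∞} [hp : Fact (1 ≤ p)] [hp' : Fact (1 ≤ p')] [p.HolderConjugate p']
  {P : Submodule ℝ (Lp m p)} {Pm : Submodule ℝ (Lp m p')} {Pmm : Submodule ℝ (Lp m p)}

lemma sum_enorm_rpow {V : Type*} [NormedAddCommGroup V] {n : ℕ} (v : Fin n → V) {q : ℝ}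
    (hq : 0 ≤ q) : ∑ i, ‖v i‖ₑ ^ q = ENNReal.ofReal (∑ i, ‖v i‖ ^ q) := by
  rw [ENNReal.ofReal_sum_of_nonneg fun i _ => by positivity]
  refine Finset.sum_congr rfl fun i _ => ?_
  rw [← ofReal_norm, ENNReal.ofReal_rpow_of_nonneg (norm_nonneg _) hq]

/-- In the summing inequality the supremum over a compact ball is attained. -/
theorem IsSumming.exists_sum_le {q : ℝ} (hq : 1 ≤ q) {T : P →L[ℝ] E} (hT : IsSumming q Pm T)
    (hP : P ≤ Pmm) [CompactSpace (TauBall Pm Pmm)] :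
    ∃ B : ℝ, 0 ≤ B ∧ ∀ (n : ℕ) (f : Fin n → P), ∃ k : TauBall Pm Pmm,
      ∑ i, ‖T (f i)‖ ^ q ≤ B * ∑ i, ‖TauBall.toContinuousMap hP (f i) k‖ ^ q := by
  have hq0 : 0 < q := one_pos.trans_le hq
  obtain ⟨K, hK⟩ := hT
  refine ⟨(K : ℝ) ^ q, by positivity, fun n f => ?_⟩
  let G : TauBall Pm Pmm → ℝ := fun k => ∑ i, ‖TauBall.toContinuousMap hP (f i) k‖ ^ q
  have hG : Continuous G := continuous_finsetSum _ fun i _ =>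
    (TauBall.toContinuousMap hP (f i)).continuous.norm.rpow_const fun _ => Or.inr hq0.le
  have : Nonempty (TauBall Pm Pmm) := ⟨⟨0, by simp⟩⟩
  obtain ⟨k, -, hk⟩ := isCompact_univ.exists_isMaxOn Set.univ_nonempty hG.continuousOn
  refine ⟨k, ?_⟩
  have hG0 : 0 ≤ G k := Finset.sum_nonneg fun i _ => by positivity
  have h1 : (∑ i, ‖T (f i)‖ₑ ^ q) ^ (1 / q) ≤ K * (ENNReal.ofReal (G k)) ^ (1 / q) := by
    refine (hK n f).trans ?_
    gcongr
    refine iSup₂_le fun g hg => ?_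
    rw [sum_enorm_rpow _ hq0.le]
    have hle : G ⟨g, hg⟩ ≤ G k := hk (Set.mem_univ _)
    simp only [G, TauBall.toContinuousMap_apply] at hle
    simp only [G, TauBall.toContinuousMap_apply]
    exact ENNReal.rpow_le_rpow (ENNReal.ofReal_le_ofReal hle) (by positivity)
  have h2 := ENNReal.rpow_le_rpow h1 hq0.le
  rw [ENNReal.mul_rpow_of_nonneg _ _ hq0.le, ← ENNReal.rpow_mul, ← ENNReal.rpow_mul,
    one_div_mul_cancel hq0.ne', ENNReal.rpow_one, ENNReal.rpow_one, sum_enorm_rpow _ hq0.le,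
    ← ENNReal.ofReal_coe_nnreal, ENNReal.ofReal_rpow_of_nonneg K.coe_nonneg hq0.le,
    ← ENNReal.ofReal_mul (by positivity)] at h2
  exact (ENNReal.ofReal_le_ofReal_iff (by positivity)).1 h2

lemma IsNorming.exists_norm_toContinuousMap_le (h : IsNorming P Pm) (hP : P ≤ Pmm)
    [CompactSpace (TauBall Pm Pmm)] :
    ∃ C : ℝ, 0 ≤ C ∧ ∀ f : P,
      ‖(TauBall.toContinuousMap hP f : C(TauBall Pm Pmm, X))‖ ≤ C * ‖f‖ := by
  obtain ⟨C, hC, h⟩ := h.exists_norm_pairing_le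
  refine ⟨C, hC, fun f => (ContinuousMap.norm_le _ (by positivity)).2 fun g => ?_⟩
  refine (h f g.1).trans ?_
  exact mul_le_of_le_one_right (by positivity) (mem_closedBall_zero_iff.1 g.2)

/-- Integration against a fixed element of an `m`-dual, as a bounded operator. -/
lemma IsNorming.exists_clm (h : IsNorming P Pm) (g : Pm) :
    ∃ L : P →L[ℝ] X, ∀ f : P, L f = pairing (f : Lp m p) (g : Lp m p') := by
  obtain ⟨C, hC, h⟩ := h.exists_norm_pairing_le
  let L : P →ₗ[ℝ] X :=
    { toFun := fun f => pairing (f : Lp m p) (g : Lp m p')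
      map_add' := fun f f' => pairing_add_left (f : Lp m p) (f' : Lp m p) (g : Lp m p')
      map_smul' := fun c f => pairing_smul_left c (f : Lp m p) (g : Lp m p') }
  exact ⟨L.mkContinuous (C * ‖g‖) fun f => (h f g).trans (le_of_eq (by ring)), fun f => rfl⟩

/-- A weakly null sequence with relatively compact range is norm null. -/
lemma tendsto_zero_of_isCompact_of_dual {V : Type*} [NormedAddCommGroup V] [NormedSpace ℝ V]
    {S : Set V} (hS : IsCompact S) {x : ℕ → V} (hx : ∀ n, x n ∈ S)
    (h : ∀ l : StrongDual ℝ V, Tendsto (fun n => l (x n)) atTop (𝓝 0)) :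
    Tendsto x atTop (𝓝 0) := by
  refine hS.tendsto_nhds_of_unique_mapClusterPt (Eventually.of_forall hx) fun y _ hy => ?_
  refine SeparatingDual.eq_iff_forall_dual_eq (R := ℝ) |>.2 fun l => ?_
  have h1 : MapClusterPt (l y) atTop (fun n => l (x n)) :=
    hy.continuousAt_comp l.continuous.continuousAt
  rw [map_zero]
  exact eq_of_nhds_neBot (ClusterPt.mono h1 (h l))

lemma exists_norm_le_of_dual_bounded {V : Type*} [NormedAddCommGroup V] [NormedSpace ℝ V]
    {x : ℕ → V} (h : ∀ l : StrongDual ℝ V, ∃ r, Tendsto (fun n => l (x n)) atTop (𝓝 r)) :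
    ∃ C, ∀ n, ‖x n‖ ≤ C := by
  obtain ⟨C, hC⟩ := banach_steinhaus
    (g := fun n => NormedSpace.inclusionInDoubleDual ℝ V (x n)) fun l => by
      obtain ⟨r, hr⟩ := h l
      obtain ⟨C, hC⟩ := hr.norm.bddAbove_range
      exact ⟨C, fun n => hC ⟨n, rfl⟩⟩
  refine ⟨C, fun n => ?_⟩
  have := (NormedSpace.inclusionInDoubleDualLi (𝕜 := ℝ) (E := V)).norm_map (x n)
  exact this.symm.le.trans (hC n)

/-- If the unit ball is `τ_m`-compact, then `τ_m`-sequentially completely continuous operators are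
completely continuous. -/
theorem IsTauSeqCompletelyContinuous.isCompletelyContinuous {T : P →L[ℝ] E}
    (hT : IsTauSeqCompletelyContinuous Pm T) (hP : IsNorming P Pm) (hc : IsTauCompactBall P Pm) :
    IsCompletelyContinuous T := by
  intro f f₀ hf
  have hl : ∀ l : StrongDual ℝ P, Tendsto (fun n => l (f n - f₀)) atTop (𝓝 0) := by
    intro l
    have h1 : Tendsto (fun n => l (f n)) atTop (𝓝 (l f₀)) :=
      ((WeakBilin.eval_continuous (topDualPairing ℝ P).flip l).tendsto _).comp hf
    simpa [map_sub] using h1.sub_const (l f₀)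
  obtain ⟨C, hC⟩ := exists_norm_le_of_dual_bounded fun l => ⟨0, hl l⟩
  have key : ∀ h : Pm, Tendsto (fun n => ‖pairing ((f n - f₀ : P) : Lp m p) (h : Lp m p')‖) atTop
      (𝓝 0) := by
    intro h
    obtain ⟨L, hL⟩ := hP.exists_clm h
    have hS : IsCompact ((fun f : P => pairing (f : Lp m p) (h : Lp m p')) ''
        Metric.closedBall (0 : P) 1) :=
      @IsCompact.image _ _ (tauTopology P Pm) _ _ _ hc (continuous_tauTopology h)
    have hR : 0 < |C| + 1 := by positivity
    have h2 : Tendsto (fun n => L ((|C| + 1)⁻¹ • (f n - f₀))) atTop (𝓝 0) := by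
      refine tendsto_zero_of_isCompact_of_dual hS (fun n => ⟨(|C| + 1)⁻¹ • (f n - f₀), ?_, ?_⟩)
        fun l => ?_
      · rw [mem_closedBall_zero_iff, norm_smul, norm_inv, Real.norm_of_nonneg hR.le,
          inv_mul_le_iff₀ hR]
        linarith [hC n, le_abs_self C]
      · exact (hL _).symm
      · have := (hl (l.comp L)).const_mul (|C| + 1)⁻¹
        rw [mul_zero] at this
        refine this.congr fun n => ?_
        rw [map_smul, map_smul]
        rfl
    have h3 := (h2.const_smul (|C| + 1)).norm
    rw [smul_zero, norm_zero] at h3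
    refine h3.congr fun n => ?_
    rw [map_smul, smul_inv_smul₀ hR.ne', hL]
  have h1 := hT (fun n => f n - f₀) ⟨C, hC⟩ key
  rw [tendsto_iff_norm_sub_tendsto_zero]
  exact h1.congr fun n => by rw [map_sub]

/-- A summing operator is dominated by a probability measure on the unit ball of the `m`-dual, if
this ball is compact. -/
theorem IsDualSystem.exists_measure_dominating (hsys : IsDualSystem P Pm Pmm) {q : ℝ} (hq : 1 ≤ q)
    {T : P →L[ℝ] E} (hT : IsSumming q Pm T) [CompactSpace (TauBall Pm Pmm)]
    [MeasurableSpace (TauBall Pm Pmm)] [BorelSpace (TauBall Pm Pmm)] :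
    ∃ (μ : Measure (TauBall Pm Pmm)) (B : ℝ), 0 ≤ B ∧ IsProbabilityMeasure μ ∧ μ.Regular ∧
      ∀ f, ‖T f‖ ^ q ≤ B * ∫ k, ‖TauBall.toContinuousMap hsys.le_bidual f k‖ ^ q ∂μ := by
  have : T2Space (TauBall Pm Pmm) := TauBall.t2Space hsys.bidual_norming
  obtain ⟨B, hB, h⟩ := hT.exists_sum_le hq hsys.le_bidual
  obtain ⟨μ, h1, h2, h3⟩ := exists_measure_norm_rpow_le_integral
    (TauBall.toContinuousMap hsys.le_bidual) (T : P →ₗ[ℝ] E) (one_pos.trans_le hq) h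
  exact ⟨μ, B, hB, h1, h2, h3⟩

end Summing

end VecLp

theorem theorem3p3 {Ω X E : Type*} [MeasurableSpace Ω]
    [NormedAddCommGroup X] [NormedSpace ℝ X] [CompleteSpace X]
    [NormedAddCommGroup E] [NormedSpace ℝ E] [CompleteSpace E]
    (m : VectorMeasure Ω X) (p p' : ℝ≥0∞) [Fact (1 ≤ p)] [Fact (1 ≤ p')] [p.HolderConjugate p']
    (P : Submodule ℝ (VecLp.Lp m p)) (Pm : Submodule ℝ (VecLp.Lp m p'))
    (Pmm : Submodule ℝ (VecLp.Lp m p)) (hsys : VecLp.IsDualSystem P Pm Pmm)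
    (q : ℝ) (hq : 1 ≤ q) (T : P →L[ℝ] E) (hT : VecLp.IsSumming q Pm T) :
    (VecLp.IsTauCompactBall Pm Pmm → VecLp.IsTauSeqCompletelyContinuous Pm T) ∧
    (VecLp.IsTauCompactBall P Pm → VecLp.IsTauCompactBall Pm Pmm →
      VecLp.IsCompletelyContinuous T) ∧
    (VecLp.IsTauCompactBall Pm Pmm → VecLp.IsReflexive X → VecLp.IsWeaklyCompact T) := by
  have hseq : VecLp.IsTauCompactBall Pm Pmm → VecLp.IsTauSeqCompletelyContinuous Pm T := by
    rintro hc f ⟨C, hC⟩ hf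
    have := VecLp.TauBall.compactSpace hc
    borelize (VecLp.TauBall Pm Pmm)
    obtain ⟨μ, B, -, hμ, -, hμT⟩ := hsys.exists_measure_dominating hq hT
    obtain ⟨D, hD, hDf⟩ := hsys.norming.exists_norm_toContinuousMap_le hsys.le_bidual
    have := VecLp.TauBall.t2Space hsys.bidual_norming
    exact VecLp.tendsto_norm_of_dominated (T := (T : P →ₗ[ℝ] E)) (one_pos.trans_le hq) hμT
      (fun n => (hDf (f n)).trans (mul_le_mul_of_nonneg_left (hC n) hD)) fun k => hf k.1
  refine ⟨hseq, fun h1 h2 => (hseq h2).isCompletelyContinuous hsys.norming h1, fun hc hX => ?_⟩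
  have := VecLp.TauBall.compactSpace hc
  borelize (VecLp.TauBall Pm Pmm)
  obtain ⟨μ, B, hB, hμ, hμr, hμT⟩ := hsys.exists_measure_dominating hq hT
  obtain ⟨D, hD, hDf⟩ := hsys.norming.exists_norm_toContinuousMap_le hsys.le_bidual
  have := VecLp.TauBall.t2Space hsys.bidual_norming
  exact VecLp.isWeaklyCompact_of_dominated hX hq hB hμT (M := D)
    fun f hf => (hDf f).trans (mul_le_of_le_one_right hD hf)
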